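/- Let $A$ be a self-adjoint, positive definite operator with compact resolvent on a complex Hilbert space $H$ with inner product $(\cdot,\cdot)$ and norm $\|\cdot\|$. For $s\in\mathbb R$ let $\mathcal D(A^s)$ be the usual scale of domains of the fractional powers of $A$: for $s\ge 0$ a subspace of $H$, for $s<0$ the completion of $H$ in the norm $\|A^s\cdot\|$; each $A^r$ acts on the whole scale, mapping $\mathcal D(A^s)$ to $\mathcal D(A^{s-r})$. Let $\sigma,\tau,m>0$ and let $(\alpha,\beta,\gamma)\in Q$, where $$Q=\{(\alpha,\beta,\gamma)\in[0,1]\times[0,1]\times(0,1] : \alpha>\tfrac{\beta+1}{2}\}.$$ Let $\mathcal H=\mathcal D(A^{1/2})\times\mathcal D(A^{\gamma/2})\times H\times H$ be the Hilbert space with inner product $$\langle U_1,U_2\rangle_{\mathcal H}=\sigma(A^{1/2}u_1,A^{1/2}u_2)+m(A^{\gamma/2}v_1,A^{\gamma/2}v_2)+(v_1,v_2)+(\theta_1,\theta_2)+\tau(q_1,q_2),$$ $U_i=(u_i,v_i,\theta_i,q_i)$, and let $\mathcal A$ be the operator $$\mathcal A(u,v,\theta,q)=\Big(v,\ -(I+mA^\gamma)^{-1}(\sigma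 Au-A^\alpha\theta),\ -A^\alpha v+A^{\beta/2}q,\ \tfrac1\tau(-q-A^{\beta/2}\theta)\Big)$$ on $\mathcal H$ with domain $$\mathcal D(\mathcal A)=\{(u,v,\theta,q)\in\mathcal H : v\in\mathcal D(A^{1/2}),\ \sigma Au-A^\alpha\theta\in\mathcal D(A^{-\gamma/2}),\ -A^\alpha v+A^{\beta/2}q\in H,\ q+A^{\beta/2}\theta\in H\}.$$ Then $\mathcal A$ is closed and densely defined, $\operatorname{Re}\langle\mathcal AU,U\rangle_{\mathcal H}=-\|q\|^2$ for every $U=(u,v,\theta,q)\in\mathcal D(\mathcal A)$, both $\mathcal A$ and its adjoint $\mathcal A^*$ are dissipative, and $\mathcal A$ generates a $C_0$-semigroup of contractions on $\mathcal H$. -/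

import Mathlib

open scoped InnerProductSpace ENNReal NNReal

noncomputable section

namespace Thermoelastic

/-! ### Positive definite self-adjoint operators with compact resolvent -/

section Operators

variable {H : Type*} [NormedAddCommGroup H] [InnerProductSpace ℂ H]

/-- `B` has compact resolvent: for some `z`, the map `B - z` is a bijection of the domain of `B`
onto `H` whose inverse `S` is bounded and compact. -/
def HasCompactResolvent (B : H →ₗ.[ℂ] H) : Prop :=
  ∃ (z : ℂ) (S : H →L[ℂ] H), IsCompactOperator S ∧
    (∀ x : B.domain, S (B x - z • (x : H)) = x) ∧
    ∀ y : H, ∃ x : B.domain, (x : H) = S y ∧ B x - z • (x : H) = y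

end Operators

/-- A self-adjoint (hence densely defined), positive definite operator with compact resolvent on
the complex Hilbert space `H`. -/
structure PositiveOperator (H : Type*) [NormedAddCommGroup H] [InnerProductSpace ℂ H]
    [CompleteSpace H] where
  op : H →ₗ.[ℂ] H
  isSelfAdjoint : IsSelfAdjoint op
  pos : ∀ x : op.domain, (x : H) ≠ 0 → 0 < (⟪op x, (x : H)⟫_ℂ).re
  hasCompactResolvent : HasCompactResolvent op

namespace PositiveOperator

variable {H : Type*} [NormedAddCommGroup H] [InnerProductSpace ℂ H] [CompleteSpace H]
variable (A : PositiveOperator H)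

theorem symmetric {x y x' y' : H} (hx : (x, x') ∈ A.op.graph) (hy : (y, y') ∈ A.op.graph) :
    ⟪x', y⟫_ℂ = ⟪x, y'⟫_ℂ := by
  obtain ⟨a, rfl, rfl⟩ := (LinearPMap.mem_graph_iff _).1 hx
  obtain ⟨b, rfl, rfl⟩ := (LinearPMap.mem_graph_iff _).1 hy
  have h := LinearPMap.adjoint_isFormalAdjoint A.isSelfAdjoint.dense_domain
  rw [LinearPMap.isSelfAdjoint_def.1 A.isSelfAdjoint] at h
  exact h a b

theorem exists_inverse : ∃ T : H →L[ℂ] H, IsCompactOperator T ∧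
    ∀ x y : H, (x, y) ∈ A.op.graph ↔ x = T y := by
  obtain ⟨z, S, hS, h1, h2⟩ := A.hasCompactResolvent
  have key : ∀ x y : H, (x, y) ∈ A.op.graph ↔ x = S (y - z • x) := by
    intro x y
    constructor
    · intro h
      obtain ⟨a, ha, rfl⟩ := (LinearPMap.mem_graph_iff _).1 h
      dsimp at ha
      subst ha
      exact (h1 a).symm
    · intro h
      obtain ⟨a, ha, hb⟩ := h2 (y - z • x)
      rw [← h] at ha
      rw [LinearPMap.mem_graph_iff]
      refine ⟨a, ha, ?_⟩
      rw [ha] at hb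
      simpa using hb
  by_cases hz : z = 0
  · subst hz
    exact ⟨S, hS, by simpa using key⟩
  have hμ : -z⁻¹ ≠ 0 := by simpa using hz
  rcases hS.hasEigenvalue_or_mem_resolventSet hμ with h | h
  · exfalso
    obtain ⟨x, hx⟩ := h.exists_hasEigenvector
    have hx1 : S x = -z⁻¹ • x := by simpa using hx.apply_eq_smul
    have hx0 : (x, (0 : H)) ∈ A.op.graph := by
      rw [key]
      simp [hx1, smul_smul, hz]
    obtain ⟨a, ha, hb⟩ := (LinearPMap.mem_graph_iff _).1 hx0
    have := A.pos a (by rw [ha]; exact hx.2)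
    rw [hb] at this
    simp at this
  · rw [spectrum.mem_resolventSet_iff] at h
    have hu : IsUnit ((1 : H →L[ℂ] H) + z • S) := by
      have h3 : (1 : H →L[ℂ] H) + z • S
          = (-z) • (algebraMap ℂ (H →L[ℂ] H) (-z⁻¹) - S) := by
        rw [smul_sub, Algebra.algebraMap_eq_smul_one, smul_smul]
        simp [hz]
      rw [h3]
      have h4 : (-z) • (algebraMap ℂ (H →L[ℂ] H) (-z⁻¹) - S)
          = algebraMap ℂ (H →L[ℂ] H) (-z) * (algebraMap ℂ (H →L[ℂ] H) (-z⁻¹) - S) := by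
        rw [Algebra.smul_def]
      rw [h4]
      exact ((isUnit_iff_ne_zero.2 (neg_ne_zero.2 hz)).map (algebraMap ℂ (H →L[ℂ] H))).mul h
    obtain ⟨u, hu⟩ := hu
    refine ⟨(↑u⁻¹ : H →L[ℂ] H) ∘L S, hS.clm_comp _, fun x y => ?_⟩
    rw [key]
    have e1 : (↑u : H →L[ℂ] H) x = x + z • S x := by rw [hu]; simp
    have i1 : ∀ w, (↑u⁻¹ : H →L[ℂ] H) ((↑u : H →L[ℂ] H) w) = w := fun w => by
      exact congrArg (fun B : H →L[ℂ] H => B w) (Units.inv_mul u)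
    have i2 : ∀ w, (↑u : H →L[ℂ] H) ((↑u⁻¹ : H →L[ℂ] H) w) = w := fun w => by
      exact congrArg (fun B : H →L[ℂ] H => B w) (Units.mul_inv u)
    have e2 : x = S (y - z • x) ↔ (↑u : H →L[ℂ] H) x = S y := by
      rw [e1, map_sub, map_smul, eq_sub_iff_add_eq]
    rw [e2, ContinuousLinearMap.comp_apply]
    constructor
    · intro h; rw [← h, i1]
    · intro h; rw [h, i2]

/-! ### Eigenspaces, eigenvector expansions, fractional powers -/

/-- The eigenspace `{x ∈ D(A) : A x = l x}`. -/
def eig (l : ℝ) : Submodule ℂ H :=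
  A.op.graph.comap (LinearMap.prod LinearMap.id ((l : ℂ) • LinearMap.id))

theorem mem_eig {l : ℝ} {x : H} : x ∈ A.eig l ↔ (x, (l : ℂ) • x) ∈ A.op.graph := Iff.rfl

instance completeSpace_eig (l : ℝ) : CompleteSpace (A.eig l) := by
  have hc : _root_.IsClosed (A.op.graph : Set (H × H)) := A.isSelfAdjoint.isClosed
  have : _root_.IsClosed (A.eig l : Set H) :=
    hc.preimage (f := fun x : H => (x, (l : ℂ) • x)) (by fun_prop)
  exact this.completeSpace_coe

theorem exists_le_of_eig : ∃ c : ℝ, 0 < c ∧ ∀ (l : ℝ) (x : A.eig l), x ≠ 0 → c ≤ l := by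
  obtain ⟨T, -, hT⟩ := A.exists_inverse
  refine ⟨(‖T‖ + 1)⁻¹, by positivity, fun l x hx => ?_⟩
  have hx' : (x : H) ≠ 0 := by simpa using hx
  have hpos : 0 < l := by
    obtain ⟨a, ha, hb⟩ := (LinearPMap.mem_graph_iff _).1 (A.mem_eig.1 x.2)
    change (a : H) = x at ha
    change A.op a = (l : ℂ) • (x : H) at hb
    have h := A.pos a (by rwa [ha])
    rw [hb, ha, inner_smul_left, Complex.conj_ofReal, Complex.re_ofReal_mul] at h
    have h2 : 0 ≤ (⟪(x : H), (x : H)⟫_ℂ).re := inner_self_nonneg (𝕜 := ℂ) (x := (x : H))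
    by_contra! hl
    nlinarith
  have h := (hT _ _).1 (A.mem_eig.1 x.2)
  have hn : ‖(x : H)‖ ≤ ‖T‖ * (l * ‖(x : H)‖) := by
    calc ‖(x : H)‖ = ‖T ((l : ℂ) • (x : H))‖ := by rw [← h]
      _ ≤ ‖T‖ * ‖(l : ℂ) • (x : H)‖ := T.le_opNorm _
      _ = _ := by rw [norm_smul, Complex.norm_real, Real.norm_of_nonneg hpos.le]
  have hxn : 0 < ‖(x : H)‖ := norm_pos_iff.2 hx'
  have h1 : 1 ≤ ‖T‖ * l := by
    by_contra! hlt
    nlinarith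
  rw [inv_le_iff_one_le_mul₀ (by positivity)]
  nlinarith

theorem orthogonalFamily_eig :
    OrthogonalFamily ℂ (fun l => A.eig l) fun l => (A.eig l).subtypeₗᵢ := by
  intro l k hlk x y
  have h := A.symmetric (A.mem_eig.1 x.2) (A.mem_eig.1 y.2)
  rw [inner_smul_left, inner_smul_right, Complex.conj_ofReal] at h
  have h2 : ((l : ℂ) - k) * ⟪(x : H), (y : H)⟫_ℂ = 0 := by rw [sub_mul, h, sub_self]
  rcases mul_eq_zero.1 h2 with h3 | h3
  · exact absurd (by exact_mod_cast sub_eq_zero.1 h3) hlk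
  · exact h3

theorem iSup_eig_orthogonal : (⨆ l, A.eig l)ᗮ = ⊥ := by
  obtain ⟨T, hc, hT⟩ := A.exists_inverse
  have hs : T.IsSymmetric := fun x y => by
    exact (A.symmetric ((hT _ _).2 rfl : (T x, x) ∈ A.op.graph)
      ((hT _ _).2 rfl : (T y, y) ∈ A.op.graph)).symm
  have h := ContinuousLinearMap.orthogonalComplement_iSup_eigenspaces_eq_bot hc hs
  rw [eq_bot_iff, ← h]
  apply Submodule.orthogonal_le
  refine iSup_le fun μ x hx => ?_
  by_cases hx0 : x = 0
  · rw [hx0]; exact Submodule.zero_mem _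
  have hx1 : T x = μ • x := by simpa using Module.End.mem_eigenspace_iff.1 hx
  have hg : (T x, x) ∈ A.op.graph := (hT _ _).2 rfl
  have hμ : μ ≠ 0 := by
    rintro rfl
    rw [hx1, zero_smul] at hg
    exact hx0 (LinearPMap.graph_fst_eq_zero_snd _ hg rfl)
  have hr := hs.conj_eigenvalue_eq_self (Module.End.hasEigenvalue_of_hasEigenvector ⟨hx, hx0⟩)
  obtain ⟨r, rfl⟩ := Complex.conj_eq_iff_real.1 hr
  refine Submodule.mem_iSup_of_mem r⁻¹ ?_
  rw [mem_eig]
  have := A.op.graph.smul_mem ((r : ℂ)⁻¹) hg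
  rw [Prod.smul_mk, hx1, smul_smul, inv_mul_cancel₀ hμ, one_smul] at this
  rwa [Complex.ofReal_inv]

/-- Formal eigenvector series `∑ f_l`, `f_l` in the eigenspace of `l`. They contain all the spaces
`D(A ^ s)`, `s ∈ ℝ`, also those with `s < 0`. -/
abbrev FormalSeries : Type _ := ∀ l : ℝ, A.eig l

/-- The eigenvector expansion of a vector, which identifies `H` with a space of formal series. -/
def expand : H →ₗ[ℂ] A.FormalSeries :=
  LinearMap.pi fun l => ((A.eig l).orthogonalProjectionOnto : H →ₗ[ℂ] A.eig l)

/-- The operator `g(A)` on formal series, which multiplies the component of the eigenvalue `l` by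
`g l`. -/
def mult (g : ℝ → ℝ) : A.FormalSeries →ₗ[ℂ] A.FormalSeries :=
  LinearMap.pi fun l => (g l : ℂ) • LinearMap.proj l

/-- `A ^ s` on formal series, for every real `s`. -/
def formalPow (s : ℝ) : A.FormalSeries →ₗ[ℂ] A.FormalSeries := A.mult fun l => l ^ s

/-- The formal series that lie in `H`. -/
def inH : Submodule ℂ A.FormalSeries := LinearMap.range A.expand

/-- The space `D(A ^ s) = {f : A ^ s f ∈ H}`, `s ∈ ℝ`, as a space of formal series. -/
def scale (s : ℝ) : Submodule ℂ A.FormalSeries := A.inH.comap (A.formalPow s)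

@[simp] theorem expand_apply (x : H) (l : ℝ) :
    A.expand x l = (A.eig l).orthogonalProjectionOnto x := rfl

@[simp] theorem mult_apply (g : ℝ → ℝ) (f : A.FormalSeries) (l : ℝ) :
    A.mult g f l = (g l : ℂ) • f l := rfl

theorem expand_injective : Function.Injective A.expand := by
  rw [injective_iff_map_eq_zero]
  intro x hx
  have : x ∈ (⨆ l, A.eig l)ᗮ := by
    rw [← Submodule.iInf_orthogonal, Submodule.mem_iInf]
    intro l
    rw [← Submodule.orthogonalProjectionOnto_eq_zero_iff]
    exact congrFun hx l
  rwa [A.iSup_eig_orthogonal, Submodule.mem_bot] at this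

theorem isHilbertSum : IsHilbertSum ℂ (fun l => A.eig l) fun l => (A.eig l).subtypeₗᵢ := by
  refine IsHilbertSum.mkInternal _ A.orthogonalFamily_eig ?_
  rw [(Submodule.topologicalClosure_eq_top_iff).2 A.iSup_eig_orthogonal]

theorem expand_symm (w : lp (fun l => A.eig l) 2) :
    A.expand (A.isHilbertSum.linearIsometryEquiv.symm w) = w := by
  funext l
  have hs := A.isHilbertSum.hasSum_linearIsometryEquiv_symm w
  have h2 := (A.eig l).orthogonalProjectionOnto.hasSum hs
  rw [expand_apply]
  refine h2.unique ?_
  have : (fun k => (A.eig l).orthogonalProjectionOnto ((A.eig k).subtypeₗᵢ (w k)))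
      = fun k => if k = l then w l else 0 := by
    funext k
    split_ifs with hk
    · subst hk
      exact Submodule.orthogonalProjectionOnto_mem_subspace_eq_self (w k)
    · rw [Submodule.orthogonalProjectionOnto_eq_zero_iff, Submodule.mem_orthogonal]
      intro u hu
      exact A.orthogonalFamily_eig (Ne.symm hk) ⟨u, hu⟩ (w k)
  rw [this]
  exact hasSum_ite_eq l (w l)

/-- A formal series lies in `H` if and only if it is square summable. -/
theorem mem_inH_iff (f : A.FormalSeries) : f ∈ A.inH ↔ Memℓp f 2 := by
  constructor
  · rintro ⟨x, rfl⟩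
    have h := A.expand_symm (A.isHilbertSum.linearIsometryEquiv x)
    rw [LinearIsometryEquiv.symm_apply_apply] at h
    rw [h]
    exact lp.memℓp _
  · intro h
    exact ⟨_, A.expand_symm ⟨f, h⟩⟩

theorem mult_mem_inH {g : ℝ → ℝ} {C : ℝ} (hg : ∀ (l : ℝ) (x : A.eig l), x ≠ 0 → |g l| ≤ C)
    {f : A.FormalSeries} (hf : f ∈ A.inH) : A.mult g f ∈ A.inH := by
  rw [mem_inH_iff] at hf ⊢
  refine (hf.const_smul (C : ℂ)).mono' fun l => ?_
  by_cases h : f l = 0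
  · simp [h]
  · have := hg l _ h
    rw [mult_apply, Pi.smul_apply, norm_smul, norm_smul, Complex.norm_real, Complex.norm_real,
      Real.norm_eq_abs]
    exact mul_le_mul_of_nonneg_right (this.trans (le_abs_self C)) (norm_nonneg _)

theorem mult_congr {g h : ℝ → ℝ} (f : A.FormalSeries) (hgh : ∀ l, 0 < l → g l = h l) :
    A.mult g f = A.mult h f := by
  funext l
  obtain ⟨c, hc, hl⟩ := A.exists_le_of_eig
  by_cases h0 : f l = 0
  · simp [h0]
  · simp [hgh l (hc.trans_le (hl l _ h0))]

theorem mult_mult (g h : ℝ → ℝ) (f : A.FormalSeries) :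
    A.mult g (A.mult h f) = A.mult (fun l => g l * h l) f := by
  funext l
  simp only [mult_apply, smul_smul, Complex.ofReal_mul]

/-- The vector of `H` that a formal series in `H` represents. -/
def realize : A.inH ≃ₗ[ℂ] H := (LinearEquiv.ofInjective A.expand A.expand_injective).symm

theorem expand_realize (f : A.inH) : A.expand (A.realize f) = f := by
  have := (LinearEquiv.ofInjective A.expand A.expand_injective).apply_symm_apply f
  exact congrArg Subtype.val this

theorem realize_eq_iff (f : A.inH) (x : H) : A.realize f = x ↔ (f : A.FormalSeries) = A.expand x := by
  rw [← A.expand_injective.eq_iff, expand_realize]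

/-- The domain `D(A ^ s)` as a subspace of `H`. -/
def powDomain (s : ℝ) : Submodule ℂ H := (A.scale s).comap A.expand

/-- The fractional power `A ^ s` as an unbounded operator on `H`. -/
def pow (s : ℝ) : H →ₗ.[ℂ] H where
  domain := A.powDomain s
  toFun := A.realize.toLinearMap ∘ₗ
    LinearMap.codRestrict A.inH (A.formalPow s ∘ₗ A.expand ∘ₗ (A.powDomain s).subtype)
      fun x => x.2

theorem mem_pow_graph (s : ℝ) (x y : H) :
    (x, y) ∈ (A.pow s).graph ↔ A.formalPow s (A.expand x) = A.expand y := by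
  rw [LinearPMap.mem_graph_iff]
  constructor
  · rintro ⟨a, rfl, rfl⟩
    exact (A.expand_realize ⟨_, a.2⟩).symm
  · intro h
    exact ⟨⟨x, ⟨y, h.symm⟩⟩, rfl, (A.realize_eq_iff _ _).2 h⟩

/-- Consistency of the definition: `A ^ 1 = A`. -/
theorem pow_one : A.pow 1 = A.op := by
  apply LinearPMap.eq_of_eq_graph
  obtain ⟨T, -, hT⟩ := A.exists_inverse
  have hexp : ∀ (y : H) (l : ℝ), (l : ℂ) • A.expand (T y) l = A.expand y l := by
    intro y l
    apply ext_inner_left ℂ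
    intro w
    rw [inner_smul_right, expand_apply, expand_apply,
      Submodule.inner_orthogonalProjectionOnto_eq_of_mem_left,
      Submodule.inner_orthogonalProjectionOnto_eq_of_mem_left]
    have := A.symmetric (A.mem_eig.1 w.2) ((hT _ _).2 rfl : (T y, y) ∈ A.op.graph)
    rwa [inner_smul_left, Complex.conj_ofReal] at this
  ext ⟨x, y⟩
  rw [mem_pow_graph, hT]
  obtain ⟨c, hc, hl⟩ := A.exists_le_of_eig
  constructor
  · intro h
    apply A.expand_injective
    funext l
    by_cases h0 : A.expand x l - A.expand (T y) l = 0
    · exact sub_eq_zero.1 h0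
    · have hlpos := hc.trans_le (hl l _ h0)
      have h1 := congrFun h l
      rw [← hexp y l] at h1
      simp only [formalPow, mult_apply, Real.rpow_one] at h1
      exact smul_right_injective _ (by exact_mod_cast hlpos.ne') h1
  · rintro rfl
    funext l
    simp only [formalPow, mult_apply, Real.rpow_one]
    exact hexp y l

end PositiveOperator

/-! ### The thermoelastic system -/

/-- The parameters of the system: exponents `α, β, γ`, wave speed `σ > 0`, relaxation parameter
`τ > 0`, and inertial coefficient `m > 0`. -/
structure Params where
  α : ℝ
  β : ℝ
  γ : ℝ
  σ : ℝ
  τ : ℝ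
  m : ℝ
  σ_pos : 0 < σ
  τ_pos : 0 < τ
  m_pos : 0 < m

/-- The parameter region `Q`. -/
def Q : Set (ℝ × ℝ × ℝ) :=
  {x | x.1 ∈ Set.Icc 0 1 ∧ x.2.1 ∈ Set.Icc 0 1 ∧ x.2.2 ∈ Set.Ioc 0 1 ∧ (x.2.1 + 1) / 2 < x.1}

section StateSpace

variable {H : Type*} [NormedAddCommGroup H] [InnerProductSpace ℂ H] [CompleteSpace H]

/-- The state space `D(A ^ (1 / 2)) × D(A ^ (γ / 2)) × H × H`. -/
def StateSpace (A : PositiveOperator H) (p : Params) : Type _ :=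
  A.powDomain (1 / 2) × A.powDomain (p.γ / 2) × H × H

namespace StateSpace

variable (A : PositiveOperator H) (p : Params)

instance : AddCommGroup (StateSpace A p) :=
  inferInstanceAs (AddCommGroup (A.powDomain (1 / 2) × A.powDomain (p.γ / 2) × H × H))

instance : Module ℂ (StateSpace A p) :=
  inferInstanceAs (Module ℂ (A.powDomain (1 / 2) × A.powDomain (p.γ / 2) × H × H))

/-- The components `(u, v, θ, q)` of a state. -/
def u : StateSpace A p →ₗ[ℂ] A.powDomain (1 / 2) := LinearMap.fst ℂ _ _

def v : StateSpace A p →ₗ[ℂ] A.powDomain (p.γ / 2) := LinearMap.fst ℂ _ _ ∘ₗ LinearMap.snd ℂ _ _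

def θ : StateSpace A p →ₗ[ℂ] H :=
  LinearMap.fst ℂ _ _ ∘ₗ LinearMap.snd ℂ _ _ ∘ₗ LinearMap.snd ℂ _ _

def q : StateSpace A p →ₗ[ℂ] H :=
  LinearMap.snd ℂ _ _ ∘ₗ LinearMap.snd ℂ _ _ ∘ₗ LinearMap.snd ℂ _ _

/-- The state with components `(u, v, θ, q)`. -/
def mk (u : A.powDomain (1 / 2)) (v : A.powDomain (p.γ / 2)) (θ q : H) : StateSpace A p :=
  (u, v, θ, q)

@[simp] theorem u_mk (a : A.powDomain (1 / 2)) (b : A.powDomain (p.γ / 2)) (x y : H) :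
    u A p (mk A p a b x y) = a := rfl

@[simp] theorem v_mk (a : A.powDomain (1 / 2)) (b : A.powDomain (p.γ / 2)) (x y : H) :
    v A p (mk A p a b x y) = b := rfl

@[simp] theorem θ_mk (a : A.powDomain (1 / 2)) (b : A.powDomain (p.γ / 2)) (x y : H) :
    θ A p (mk A p a b x y) = x := rfl

@[simp] theorem q_mk (a : A.powDomain (1 / 2)) (b : A.powDomain (p.γ / 2)) (x y : H) :
    q A p (mk A p a b x y) = y := rfl

/-- The vector `A ^ (1 / 2) u`. -/
def halfU : StateSpace A p →ₗ[ℂ] H := (A.pow (1 / 2)).toFun ∘ₗ u A p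

/-- The vector `A ^ (γ / 2) v`. -/
def halfV : StateSpace A p →ₗ[ℂ] H := (A.pow (p.γ / 2)).toFun ∘ₗ v A p

/-- The energy inner product on the state space. -/
instance : Inner ℂ (StateSpace A p) where
  inner U W :=
    (p.σ : ℂ) * ⟪halfU A p U, halfU A p W⟫_ℂ + (p.m : ℂ) * ⟪halfV A p U, halfV A p W⟫_ℂ
      + ⟪(v A p U : H), (v A p W : H)⟫_ℂ + ⟪θ A p U, θ A p W⟫_ℂ + (p.τ : ℂ) * ⟪q A p U, q A p W⟫_ℂ

theorem inner_def (U W : StateSpace A p) : ⟪U, W⟫_ℂ =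
    (p.σ : ℂ) * ⟪halfU A p U, halfU A p W⟫_ℂ + (p.m : ℂ) * ⟪halfV A p U, halfV A p W⟫_ℂ
      + ⟪(v A p U : H), (v A p W : H)⟫_ℂ + ⟪θ A p U, θ A p W⟫_ℂ
      + (p.τ : ℂ) * ⟪q A p U, q A p W⟫_ℂ := rfl

theorem re_inner_self (U : StateSpace A p) : (⟪U, U⟫_ℂ).re =
    p.σ * ‖halfU A p U‖ ^ 2 + p.m * ‖halfV A p U‖ ^ 2 + ‖(v A p U : H)‖ ^ 2 + ‖θ A p U‖ ^ 2
      + p.τ * ‖q A p U‖ ^ 2 := by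
  have h : ∀ x : H, (⟪x, x⟫_ℂ).re = ‖x‖ ^ 2 := fun x => inner_self_eq_norm_sq (𝕜 := ℂ) x
  simp only [inner_def, Complex.add_re, Complex.re_ofReal_mul, h]

theorem expand_halfU (U : StateSpace A p) :
    A.expand (halfU A p U) = A.formalPow (1 / 2) (A.expand (u A p U)) :=
  A.expand_realize ⟨_, (u A p U).2⟩

theorem expand_halfV (U : StateSpace A p) :
    A.expand (halfV A p U) = A.formalPow (p.γ / 2) (A.expand (v A p U)) :=
  A.expand_realize ⟨_, (v A p U).2⟩

@[ext] theorem ext {U W : StateSpace A p} (h1 : (u A p U : H) = u A p W)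
    (h2 : (v A p U : H) = v A p W) (h3 : θ A p U = θ A p W) (h4 : q A p U = q A p W) : U = W :=
  Prod.ext (Subtype.ext h1) (Prod.ext (Subtype.ext h2) (Prod.ext h3 h4))

/-- `A ^ (-1 / 2)` and the expansion in `H`. -/
theorem exists_halfU_inv (y : H) : ∃ x : A.powDomain (1 / 2), (A.pow (1 / 2)) x = y := by
  obtain ⟨c, hc, hl⟩ := A.exists_le_of_eig
  have h1 : A.mult (fun l => l ^ (-(1 / 2) : ℝ)) (A.expand y) ∈ A.inH := by
    refine A.mult_mem_inH (C := c ^ (-(1 / 2) : ℝ)) (fun l x hx => ?_) ⟨y, rfl⟩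
    have := hl l x hx
    rw [abs_of_nonneg (Real.rpow_nonneg (hc.le.trans this) _)]
    exact Real.rpow_le_rpow_of_nonpos hc this (by norm_num)
  obtain ⟨x, hx⟩ := h1
  have h2 : (x, y) ∈ (A.pow (1 / 2)).graph := by
    rw [A.mem_pow_graph, hx, PositiveOperator.formalPow, A.mult_mult]
    rw [A.mult_congr (h := fun _ => 1)]
    · funext l; simp
    · intro l hl
      rw [← Real.rpow_add hl]; simp
  obtain ⟨a, -, ha⟩ := (LinearPMap.mem_graph_iff _).1 h2
  exact ⟨a, ha⟩

theorem halfU_eq_zero {U : StateSpace A p} (h : halfU A p U = 0) : (u A p U : H) = 0 := by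
  apply A.expand_injective
  have h1 := expand_halfU A p U
  rw [h, map_zero] at h1
  rw [map_zero]
  obtain ⟨c, hc, hl⟩ := A.exists_le_of_eig
  funext l
  by_contra h0
  have hlp := hc.trans_le (hl l _ h0)
  have h2 := congrFun h1 l
  rw [PositiveOperator.formalPow, PositiveOperator.mult_apply] at h2
  rcases smul_eq_zero.1 h2.symm with h3 | h3
  · exact (Real.rpow_pos_of_pos hlp _).ne' (by exact_mod_cast h3)
  · exact h0 h3

@[reducible] def core : InnerProductSpace.Core ℂ (StateSpace A p) where
  inner U W := ⟪U, W⟫_ℂ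
  conj_inner_symm U W := by
    simp only [inner_def, map_add, map_mul, Complex.conj_ofReal, inner_conj_symm]
  re_inner_nonneg U := by
    have := p.σ_pos
    have := p.τ_pos
    have := p.m_pos
    change 0 ≤ (⟪U, U⟫_ℂ).re
    rw [re_inner_self]
    positivity
  add_left U V W := by
    simp only [inner_def, map_add, inner_add_left, Submodule.coe_add]
    ring
  smul_left U W r := by
    simp only [inner_def, map_smul, inner_smul_left, Submodule.coe_smul]
    ring
  definite U h := by
    have hσ := p.σ_pos
    have hτ := p.τ_pos
    have hm := p.m_pos
    have h1 := re_inner_self A p U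
    rw [h, Complex.zero_re] at h1
    have a1 : 0 ≤ p.σ * ‖halfU A p U‖ ^ 2 := by positivity
    have a2 : 0 ≤ p.m * ‖halfV A p U‖ ^ 2 := by positivity
    have a3 : 0 ≤ ‖(v A p U : H)‖ ^ 2 := by positivity
    have a4 : 0 ≤ ‖θ A p U‖ ^ 2 := by positivity
    have a5 : 0 ≤ p.τ * ‖q A p U‖ ^ 2 := by positivity
    have b1 : p.σ * ‖halfU A p U‖ ^ 2 = 0 := by linarith
    have b3 : ‖(v A p U : H)‖ ^ 2 = 0 := by linarith
    have b4 : ‖θ A p U‖ ^ 2 = 0 := by linarith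
    have b5 : p.τ * ‖q A p U‖ ^ 2 = 0 := by linarith
    have c1 : halfU A p U = 0 := by simpa [hσ.ne'] using b1
    have c5 : q A p U = 0 := by simpa [hτ.ne'] using b5
    apply ext A p
    · simpa using halfU_eq_zero A p c1
    · simpa using b3
    · simpa using b4
    · simpa using c5

instance : NormedAddCommGroup (StateSpace A p) :=
  @InnerProductSpace.Core.toNormedAddCommGroup ℂ _ _ _ _ (core A p)

instance : InnerProductSpace ℂ (StateSpace A p) :=
  InnerProductSpace.ofCore (core A p).toCore

theorem norm_sq (U : StateSpace A p) : ‖U‖ ^ 2 =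
    p.σ * ‖halfU A p U‖ ^ 2 + p.m * ‖halfV A p U‖ ^ 2 + ‖(v A p U : H)‖ ^ 2 + ‖θ A p U‖ ^ 2
      + p.τ * ‖q A p U‖ ^ 2 := by
  rw [← re_inner_self]
  exact (inner_self_eq_norm_sq (𝕜 := ℂ) U).symm

theorem tendsto_of_le {f : StateSpace A p →ₗ[ℂ] H} {c : ℝ} (hc : 0 < c)
    (hf : ∀ U, c * ‖f U‖ ^ 2 ≤ ‖U‖ ^ 2) {s : ℕ → StateSpace A p} (hs : CauchySeq s) :
    ∃ x, Filter.Tendsto (fun n => f (s n)) Filter.atTop (nhds x) := by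
  apply cauchySeq_tendsto_of_complete
  have hb : ∀ U, ‖f U‖ ≤ (√c)⁻¹ * ‖U‖ := fun U => by
    rw [← div_eq_inv_mul, le_div_iff₀ (Real.sqrt_pos.2 hc)]
    refine le_of_sq_le_sq ?_ (norm_nonneg _)
    rw [mul_pow, Real.sq_sqrt hc.le, mul_comm]
    exact hf U
  exact hs.map (f.mkContinuous _ hb).uniformContinuous

theorem expand_tendsto {x : ℕ → H} {y : H} (h : Filter.Tendsto x Filter.atTop (nhds y)) (l : ℝ) :
    Filter.Tendsto (fun n => A.expand (x n) l) Filter.atTop (nhds (A.expand y l)) :=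
  ((A.eig l).orthogonalProjectionOnto.continuous.tendsto y).comp h

instance : CompleteSpace (StateSpace A p) := by
  refine Metric.complete_of_cauchySeq_tendsto fun s hs => ?_
  have hσ := p.σ_pos
  have hτ := p.τ_pos
  have hm := p.m_pos
  have hn := norm_sq A p
  have a1 : ∀ U, 0 ≤ p.σ * ‖halfU A p U‖ ^ 2 := fun U => by positivity
  have a2 : ∀ U, 0 ≤ p.m * ‖halfV A p U‖ ^ 2 := fun U => by positivity
  have a3 : ∀ U, 0 ≤ ‖(v A p U : H)‖ ^ 2 := fun U => by positivity
  have a4 : ∀ U, 0 ≤ ‖θ A p U‖ ^ 2 := fun U => by positivity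
  have a5 : ∀ U, 0 ≤ p.τ * ‖q A p U‖ ^ 2 := fun U => by positivity
  obtain ⟨u', hu⟩ := tendsto_of_le A p (f := halfU A p) hσ
    (fun U => by linarith [hn U, a1 U, a2 U, a3 U, a4 U, a5 U]) hs
  obtain ⟨w, hw⟩ := tendsto_of_le A p (f := halfV A p) hm
    (fun U => by linarith [hn U, a1 U, a2 U, a3 U, a4 U, a5 U]) hs
  obtain ⟨v', hv⟩ := tendsto_of_le A p (f := (A.powDomain (p.γ / 2)).subtype ∘ₗ v A p) one_pos
    (fun U => by
      simp only [LinearMap.comp_apply, Submodule.subtype_apply]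
      linarith [hn U, a1 U, a2 U, a3 U, a4 U, a5 U]) hs
  obtain ⟨t, ht⟩ := tendsto_of_le A p (f := θ A p) one_pos
    (fun U => by linarith [hn U, a1 U, a2 U, a3 U, a4 U, a5 U]) hs
  obtain ⟨r, hr⟩ := tendsto_of_le A p (f := q A p) hτ
    (fun U => by linarith [hn U, a1 U, a2 U, a3 U, a4 U, a5 U]) hs
  obtain ⟨x, hx⟩ := exists_halfU_inv A u'
  have hvw : (v', w) ∈ (A.pow (p.γ / 2)).graph := by
    rw [A.mem_pow_graph]
    funext l
    have h1 := expand_tendsto A hw l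
    have h2 := (expand_tendsto A hv l).const_smul (((l ^ (p.γ / 2) : ℝ)) : ℂ)
    refine tendsto_nhds_unique h2 ?_
    convert h1 using 2 with n
    rw [expand_halfV]
    rfl
  obtain ⟨y, hy1, hy2⟩ := (LinearPMap.mem_graph_iff _).1 hvw
  change (y : H) = v' at hy1
  change A.pow (p.γ / 2) y = w at hy2
  refine ⟨mk A p x y t r, ?_⟩
  rw [tendsto_iff_norm_sub_tendsto_zero]
  have key : Filter.Tendsto (fun n => ‖s n - mk A p x y t r‖ ^ 2) Filter.atTop (nhds 0) := by
    have e : ∀ n, ‖s n - mk A p x y t r‖ ^ 2 =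
        p.σ * ‖halfU A p (s n) - u'‖ ^ 2 + p.m * ‖halfV A p (s n) - w‖ ^ 2
          + ‖(v A p (s n) : H) - v'‖ ^ 2 + ‖θ A p (s n) - t‖ ^ 2
          + p.τ * ‖q A p (s n) - r‖ ^ 2 := fun n => by
      rw [hn, map_sub, map_sub, map_sub, map_sub, map_sub, Submodule.coe_sub, ← hx, ← hy2, ← hy1]
      rfl
    simp only [e]
    have z : ∀ {g : ℕ → H} {b : H}, Filter.Tendsto g Filter.atTop (nhds b) →
        Filter.Tendsto (fun n => ‖g n - b‖ ^ 2) Filter.atTop (nhds 0) := fun h => by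
      simpa using (tendsto_iff_norm_sub_tendsto_zero.1 h).pow 2
    simpa using (((((z hu).const_mul p.σ).add ((z hw).const_mul p.m)).add (z hv)).add (z ht)).add
      ((z hr).const_mul p.τ)
  have := key.sqrt
  simpa [Real.sqrt_sq (norm_nonneg _)] using this

end StateSpace

variable (A : PositiveOperator H) (p : Params)

open StateSpace

/-- The formal series `σ A u - A ^ α θ`. -/
def stress : StateSpace A p →ₗ[ℂ] A.FormalSeries :=
  (p.σ : ℂ) • (A.formalPow 1 ∘ₗ A.expand ∘ₗ (A.powDomain (1 / 2)).subtype ∘ₗ u A p)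
    - A.formalPow p.α ∘ₗ A.expand ∘ₗ θ A p

/-- The formal series `-A ^ α v + A ^ (β / 2) q`. -/
def heatBalance : StateSpace A p →ₗ[ℂ] A.FormalSeries :=
  -(A.formalPow p.α ∘ₗ A.expand ∘ₗ (A.powDomain (p.γ / 2)).subtype ∘ₗ v A p)
    + A.formalPow (p.β / 2) ∘ₗ A.expand ∘ₗ q A p

/-- The formal series `q + A ^ (β / 2) θ`. -/
def fluxBalance : StateSpace A p →ₗ[ℂ] A.FormalSeries :=
  A.expand ∘ₗ q A p + A.formalPow (p.β / 2) ∘ₗ A.expand ∘ₗ θ A p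

/-- The operator `(I + m A ^ γ)⁻¹` on formal series. -/
def invInertia : A.FormalSeries →ₗ[ℂ] A.FormalSeries := A.mult fun l => (1 + p.m * l ^ p.γ)⁻¹

/-- `(I + m A ^ γ)⁻¹` inverts `I + m A ^ γ`. -/
theorem invInertia_spec (f g : A.FormalSeries) :
    invInertia A p f = g ↔ f = g + (p.m : ℂ) • A.formalPow p.γ g := by
  obtain ⟨c, hc, hl⟩ := A.exists_le_of_eig
  have e : ∀ (f : A.FormalSeries) l, f l ≠ 0 → 0 < 1 + p.m * l ^ p.γ := fun f l h => by
    have := hc.trans_le (hl l _ h)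
    have := p.m_pos
    positivity
  have e2 : ∀ (g : A.FormalSeries) l, (g + (p.m : ℂ) • A.formalPow p.γ g) l
      = ((1 + p.m * l ^ p.γ : ℝ) : ℂ) • g l := fun g l => by
    simp only [Pi.add_apply, Pi.smul_apply, PositiveOperator.formalPow,
      PositiveOperator.mult_apply, smul_smul, Complex.ofReal_add, Complex.ofReal_mul,
      Complex.ofReal_one, add_smul, one_smul]
  constructor
  · rintro rfl
    funext l
    rw [e2]
    by_cases h : f l = 0
    · simp [invInertia, h]
    · rw [invInertia, PositiveOperator.mult_apply, smul_smul, ← Complex.ofReal_mul,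
        mul_inv_cancel₀ (e f l h).ne', Complex.ofReal_one, one_smul]
  · rintro rfl
    funext l
    rw [invInertia, PositiveOperator.mult_apply, e2]
    by_cases h : g l = 0
    · simp [h]
    · rw [smul_smul, ← Complex.ofReal_mul, inv_mul_cancel₀ (e g l h).ne', Complex.ofReal_one,
        one_smul]

theorem mult_invInertia_mem {f : A.FormalSeries} (hf : f ∈ A.scale (-(p.γ / 2))) {g : ℝ → ℝ} {C : ℝ}
    (hg : ∀ l, 0 < l → |g l * (1 + p.m * l ^ p.γ)⁻¹ * l ^ (p.γ / 2)| ≤ C) :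
    A.mult g (invInertia A p f) ∈ A.inH := by
  obtain ⟨c, hc, hl⟩ := A.exists_le_of_eig
  have h := A.mult_mem_inH (g := fun l => g l * (1 + p.m * l ^ p.γ)⁻¹ * l ^ (p.γ / 2)) (C := C)
    (fun l x hx => hg l (hc.trans_le (hl l x hx))) (f := A.formalPow (-(p.γ / 2)) f) hf
  rw [PositiveOperator.formalPow, A.mult_mult] at h
  rw [invInertia, A.mult_mult]
  convert h using 1
  refine A.mult_congr _ fun l hl => ?_
  rw [mul_assoc (g l * _), ← Real.rpow_add hl]
  simp

theorem invInertia_mem_inH {f : A.FormalSeries} (hf : f ∈ A.scale (-(p.γ / 2))) :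
    invInertia A p f ∈ A.inH := by
  have hm := p.m_pos
  have h := mult_invInertia_mem A p hf (g := fun _ => 1) (C := 1 + p.m⁻¹) fun l hl => by
    have hy : l ^ p.γ = l ^ (p.γ / 2) * l ^ (p.γ / 2) := by rw [← Real.rpow_add hl]; ring_nf
    have hx : 0 < l ^ (p.γ / 2) := Real.rpow_pos_of_pos hl _
    rw [hy]
    generalize l ^ (p.γ / 2) = x at hx
    rw [abs_of_pos (by positivity), one_mul, inv_mul_le_iff₀ (by positivity)]
    have : p.m * p.m⁻¹ = 1 := mul_inv_cancel₀ hm.ne'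
    have h1 : 0 < p.m⁻¹ := by positivity
    have h2 : p.m * (x * x) * p.m⁻¹ = x * x := by
      rw [mul_comm, ← mul_assoc, inv_mul_cancel₀ hm.ne', one_mul]
    have h3 : 0 < p.m * (x * x) := by positivity
    nlinarith [sq_nonneg (x - 1)]
  have e : A.mult (fun _ => 1) (invInertia A p f) = invInertia A p f := by
    funext l; simp
  rwa [e] at h

theorem invInertia_mem_scale {f : A.FormalSeries} (hf : f ∈ A.scale (-(p.γ / 2))) :
    invInertia A p f ∈ A.scale (p.γ / 2) := by
  have hm := p.m_pos
  refine mult_invInertia_mem A p hf (C := p.m⁻¹) fun l hl => ?_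
  have hy : l ^ p.γ = l ^ (p.γ / 2) * l ^ (p.γ / 2) := by rw [← Real.rpow_add hl]; ring_nf
  have hx : 0 < l ^ (p.γ / 2) := Real.rpow_pos_of_pos hl _
  rw [hy]
  generalize l ^ (p.γ / 2) = x at hx
  rw [abs_of_pos (by positivity)]
  field_simp
  nlinarith

/-- The domain of the system operator: `v ∈ D(A ^ (1 / 2))`, `σ A u - A ^ α θ ∈ D(A ^ (-γ / 2))`,
`-A ^ α v + A ^ (β / 2) q ∈ H`, `q + A ^ (β / 2) θ ∈ H`. -/
def opDomain : Submodule ℂ (StateSpace A p) where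
  carrier := {U | (v A p U : H) ∈ A.powDomain (1 / 2) ∧ stress A p U ∈ A.scale (-(p.γ / 2)) ∧
    heatBalance A p U ∈ A.inH ∧ fluxBalance A p U ∈ A.inH}
  zero_mem' := by simp
  add_mem' := by
    rintro U W ⟨h1, h2, h3, h4⟩ ⟨k1, k2, k3, k4⟩
    simp only [Set.mem_ofPred_eq, map_add, Submodule.coe_add]
    exact ⟨add_mem h1 k1, add_mem h2 k2, add_mem h3 k3, add_mem h4 k4⟩
  smul_mem' := by
    rintro c U ⟨h1, h2, h3, h4⟩
    simp only [Set.mem_ofPred_eq, map_smul, Submodule.coe_smul]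
    exact ⟨Submodule.smul_mem _ c h1, Submodule.smul_mem _ c h2, Submodule.smul_mem _ c h3,
      Submodule.smul_mem _ c h4⟩

/-- The vector `-(I + m A ^ γ)⁻¹ (σ A u - A ^ α θ)`. -/
def acceleration (U : opDomain A p) : A.powDomain (p.γ / 2) :=
  -⟨A.realize ⟨invInertia A p (stress A p U), invInertia_mem_inH A p U.2.2.1⟩, by
    change A.expand _ ∈ A.scale (p.γ / 2)
    rw [A.expand_realize]
    exact invInertia_mem_scale A p U.2.2.1⟩

theorem expand_acceleration (U : opDomain A p) :
    A.expand (acceleration A p U : H) = -invInertia A p (stress A p U) := by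
  rw [acceleration, Submodule.coe_neg, map_neg, A.expand_realize]

/-- The system operator. -/
def systemOp : StateSpace A p →ₗ.[ℂ] StateSpace A p where
  domain := opDomain A p
  toFun :=
    { toFun := fun U => StateSpace.mk A p ⟨v A p U, U.2.1⟩ (acceleration A p U)
        (A.realize ⟨heatBalance A p U, U.2.2.2.1⟩)
        ((p.τ : ℂ)⁻¹ • A.realize (-⟨fluxBalance A p U, U.2.2.2.2⟩))
      map_add' := fun U W => by
        apply StateSpace.ext A p
        · simp only [map_add, u_mk, Submodule.coe_add]
        · apply A.expand_injective
          simp only [map_add, v_mk, Submodule.coe_add, expand_acceleration, neg_add]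
        · apply A.expand_injective
          simp only [map_add, θ_mk, Submodule.coe_add, A.expand_realize]
        · apply A.expand_injective
          simp only [map_add, q_mk, map_smul, A.expand_realize, Submodule.coe_add,
            Submodule.coe_neg, neg_add, smul_add]
      map_smul' := fun c U => by
        apply StateSpace.ext A p
        · simp only [map_smul, u_mk, Submodule.coe_smul, RingHom.id_apply]
        · apply A.expand_injective
          simp only [map_smul, v_mk, Submodule.coe_smul, expand_acceleration, RingHom.id_apply,
            smul_neg]
        · apply A.expand_injective
          simp only [map_smul, θ_mk, Submodule.coe_smul, A.expand_realize, RingHom.id_apply]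
        · apply A.expand_injective
          simp only [map_smul, q_mk, A.expand_realize, Submodule.coe_smul, Submodule.coe_neg,
            RingHom.id_apply, smul_neg]
          rw [smul_comm] }

end StateSpace

/-! ### Semigroups -/

section Semigroups

variable {X : Type*} [NormedAddCommGroup X]

/-- A `C₀`-semigroup of contractions. -/
structure IsContractionSemigroup [NormedSpace ℂ X] (T : ℝ≥0 → X →L[ℂ] X) : Prop where
  zero : T 0 = ContinuousLinearMap.id ℂ X
  add : ∀ s t, T (s + t) = T s ∘L T t
  continuous : ∀ x, Filter.Tendsto (fun t => T t x) (nhdsWithin 0 (Set.Ioi 0)) (nhds x)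
  contraction : ∀ t, ‖T t‖ ≤ 1

/-- `B` is the generator of `T`: `x ∈ D(B)` and `B x = y` if and only if `(T t x - x) / t → y` as
`t → 0+`. -/
def IsGeneratorOf [NormedSpace ℂ X] (B : X →ₗ.[ℂ] X) (T : ℝ≥0 → X →L[ℂ] X) : Prop :=
  ∀ x y : X, (x, y) ∈ B.graph ↔
    Filter.Tendsto (fun t : ℝ≥0 => ((t : ℝ) : ℂ)⁻¹ • (T t x - x)) (nhdsWithin 0 (Set.Ioi 0))
      (nhds y)

/-- `B` is dissipative. -/
def IsDissipative [InnerProductSpace ℂ X] (B : X →ₗ.[ℂ] X) : Prop :=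
  ∀ x : B.domain, (⟪B x, (x : X)⟫_ℂ).re ≤ 0

end Semigroups

end Thermoelastic

end

/-! Every coefficient of the system is a function of `A`, so the eigenspaces of `A` decouple it. On
the eigenspace of `l` the unknowns `(u, v, θ, q)` obey a four-by-four system with scalar
coefficients. Rescaling the components so that the energy becomes the Euclidean norm turns its
matrix into a skew-symmetric coupling plus the single damping entry `-1/τ` in the `q` slot
(`re_inner_block`). Each block is thus bounded and dissipative, although no bound uniform in `l` is
available.

The rescaled coordinates identify the state space isometrically with the Hilbert sum of the blocks
(`exists_isometry_coord`). The domain conditions say exactly that the formal system operator maps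
the state back into the state space (`mem_graph_systemOp`). Hence the system operator is the
block-diagonal operator on its maximal domain (`isDiagonal_systemOp`).

The rest holds for any maximal diagonal operator with bounded dissipative blocks. Its graph is cut
out by closed coordinate conditions, and its domain contains all vectors supported in one block.
Dissipativity of the operator and of its adjoint is checked block by block. The semigroup is written
down as the family of block exponentials, and dominated convergence over the blocks gives strong
continuity and the generator, with no appeal to a generation theorem. The identity for the real part
is the sum of the block identities, by Parseval. -/

namespace Thermoelastic

/-! ### Exponentials of bounded dissipative operators. -/

section BoundedGenerator

variable {F : Type*} [NormedAddCommGroup F] [InnerProductSpace ℂ F] [CompleteSpace F]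
  {M : F →L[ℂ] F}

theorem hasDerivAt_exp_smul_apply (M : F →L[ℂ] F) (x : F) (t : ℝ) :
    HasDerivAt (fun s : ℝ => NormedSpace.exp ((s : ℂ) • M) x)
      (M (NormedSpace.exp ((t : ℂ) • M) x)) t := by
  have h := (ContinuousLinearMap.apply ℂ F x).hasFDerivAt.comp_hasDerivAt (t : ℂ)
    (hasDerivAt_exp_smul_const' M (t : ℂ))
  simpa [Function.comp_def] using h.scomp t Complex.ofRealCLM.hasDerivAt

/-- With `M` applied before the exponential, contractivity bounds the derivative by `‖M x‖`; the
form with `M` outside serves the energy estimate. -/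
theorem hasDerivAt_exp_smul_apply' (M : F →L[ℂ] F) (x : F) (t : ℝ) :
    HasDerivAt (fun s : ℝ => NormedSpace.exp ((s : ℂ) • M) x)
      (NormedSpace.exp ((t : ℂ) • M) (M x)) t := by
  have h := (ContinuousLinearMap.apply ℂ F x).hasFDerivAt.comp_hasDerivAt (t : ℂ)
    (hasDerivAt_exp_smul_const M (t : ℂ))
  simpa [Function.comp_def] using h.scomp t Complex.ofRealCLM.hasDerivAt

/-- A bounded dissipative operator generates a semigroup of contractions. -/
theorem norm_exp_smul_apply_le (hM : ∀ x, (⟪M x, x⟫_ℂ).re ≤ 0) {t : ℝ} (ht : 0 ≤ t) (x : F) :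
    ‖NormedSpace.exp ((t : ℂ) • M) x‖ ≤ ‖x‖ := by
  have hd : ∀ s : ℝ, HasDerivAt (fun s : ℝ => ‖NormedSpace.exp ((s : ℂ) • M) x‖ ^ 2)
      (2 * (⟪M (NormedSpace.exp ((s : ℂ) • M) x), NormedSpace.exp ((s : ℂ) • M) x⟫_ℂ).re) s := by
    intro s
    -- The squared norm is differentiated through the real inner product, which is the real part of
    -- the complex one.
    let _ : InnerProductSpace ℝ F := InnerProductSpace.rclikeToReal ℂ F
    have h := (hasDerivAt_exp_smul_apply M x s).norm_sq
    rwa [real_inner_comm] at h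
  have ha : Antitone fun s : ℝ => ‖NormedSpace.exp ((s : ℂ) • M) x‖ ^ 2 := by
    refine antitone_of_deriv_nonpos (fun s => (hd s).differentiableAt) fun s => ?_
    rw [(hd s).deriv]
    linarith [hM (NormedSpace.exp ((s : ℂ) • M) x)]
  have h := ha ht
  simp only [Complex.ofReal_zero, zero_smul, NormedSpace.exp_zero,
    one_apply_eq_self] at h
  exact le_of_sq_le_sq h (norm_nonneg _)

/-- Mean value inequality along the orbit. The constant involves `‖M x‖` and not `‖M‖`, so it can be
square-summed over blocks whose operator norms are unbounded. -/
theorem norm_exp_smul_apply_sub_le (hM : ∀ x, (⟪M x, x⟫_ℂ).re ≤ 0) {t : ℝ} (ht : 0 ≤ t) (x : F) :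
    ‖NormedSpace.exp ((t : ℂ) • M) x - x‖ ≤ ‖M x‖ * t := by
  have h := norm_image_sub_le_of_norm_deriv_le_segment' (a := 0) (b := t)
    (fun s _ => (hasDerivAt_exp_smul_apply' M x s).hasDerivWithinAt)
    (fun s hs => norm_exp_smul_apply_le hM hs.1 (M x)) t ⟨ht, le_rfl⟩
  simpa using h

theorem tendsto_nhdsGT_coe :
    Filter.Tendsto ((↑) : ℝ≥0 → ℝ) (nhdsWithin 0 (Set.Ioi 0)) (nhdsWithin 0 (Set.Ioi 0)) :=
  tendsto_nhdsWithin_iff.2 ⟨(NNReal.continuous_coe.tendsto' 0 0 rfl).mono_left nhdsWithin_le_nhds,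
    by filter_upwards [self_mem_nhdsWithin] with t ht using NNReal.coe_pos.2 ht⟩

theorem tendsto_exp_smul_apply (M : F →L[ℂ] F) (x : F) :
    Filter.Tendsto (fun t : ℝ≥0 => NormedSpace.exp (((t : ℝ) : ℂ) • M) x)
      (nhdsWithin 0 (Set.Ioi 0)) (nhds x) := by
  have h := (hasDerivAt_exp_smul_apply M x 0).continuousAt.tendsto.comp
    (tendsto_nhdsGT_coe.mono_right nhdsWithin_le_nhds)
  simpa [Function.comp_def] using h

theorem tendsto_slope_exp_smul_apply (M : F →L[ℂ] F) (x : F) :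
    Filter.Tendsto (fun t : ℝ≥0 => ((t : ℝ) : ℂ)⁻¹ • (NormedSpace.exp (((t : ℝ) : ℂ) • M) x - x))
      (nhdsWithin 0 (Set.Ioi 0)) (nhds (M x)) := by
  have h := (hasDerivAt_exp_smul_apply M x 0).tendsto_slope_zero_right.comp tendsto_nhdsGT_coe
  refine (h.congr fun t => ?_).trans (by simp)
  simp [← Complex.ofReal_inv]

end BoundedGenerator

/-! ### Maximal diagonal operators on a Hilbert sum. -/

section Diagonal

variable {X : Type*} [NormedAddCommGroup X] [InnerProductSpace ℂ X]
  {ι : Type*} {G : ι → Type*} [∀ i, NormedAddCommGroup (G i)] [∀ i, InnerProductSpace ℂ (G i)]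

theorem norm_sq_eq_tsum (Φ : X ≃ₗᵢ[ℂ] lp G 2) (x : X) : ‖x‖ ^ 2 = ∑' i, ‖Φ x i‖ ^ 2 := by
  have h := lp.norm_rpow_eq_tsum (p := 2) (by simp) (Φ x)
  simpa using h

theorem summable_norm_sq (Φ : X ≃ₗᵢ[ℂ] lp G 2) (x : X) : Summable fun i => ‖Φ x i‖ ^ 2 := by
  have h := (lp.memℓp (Φ x)).summable (by simp)
  simpa using h

theorem hasSum_inner_coord (Φ : X ≃ₗᵢ[ℂ] lp G 2) (x y : X) :
    HasSum (fun i => ⟪Φ x i, Φ y i⟫_ℂ) ⟪x, y⟫_ℂ := by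
  rw [← Φ.inner_map_map]
  exact lp.hasSum_inner _ _

theorem continuous_coord (Φ : X ≃ₗᵢ[ℂ] lp G 2) (i : ι) : Continuous fun x => Φ x i :=
  (lp.evalCLM ℂ G 2 i).continuous.comp Φ.continuous

theorem inner_symm_single [DecidableEq ι] (Φ : X ≃ₗᵢ[ℂ] lp G 2) (i : ι) (a : G i) (x : X) :
    ⟪Φ.symm (lp.single 2 i a), x⟫_ℂ = ⟪a, Φ x i⟫_ℂ := by
  rw [← Φ.inner_map_map, Φ.apply_symm_apply, lp.inner_single_left]

/-- Dominated convergence in a Hilbert sum. -/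
theorem tendsto_of_coord (Φ : X ≃ₗᵢ[ℂ] lp G 2) {κ : Type*} {l : Filter κ} {f : κ → X} {y : X}
    {b : ι → ℝ} (hb : Summable fun i => b i ^ 2)
    (hlim : ∀ i, Filter.Tendsto (fun k => Φ (f k) i) l (nhds (Φ y i)))
    (hbound : ∀ᶠ k in l, ∀ i, ‖Φ (f k) i - Φ y i‖ ≤ b i) : Filter.Tendsto f l (nhds y) := by
  rw [tendsto_iff_norm_sub_tendsto_zero]
  have h : Filter.Tendsto (fun k => ∑' i, ‖Φ (f k - y) i‖ ^ 2) l (nhds (∑' _ : ι, (0 : ℝ))) := by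
    refine tendsto_tsum_of_dominated_convergence hb (fun i => ?_) ?_
    · have h1 := (tendsto_iff_norm_sub_tendsto_zero.1 (hlim i)).pow 2
      simpa using h1
    · filter_upwards [hbound] with k hk i
      rw [Real.norm_of_nonneg (by positivity), map_sub, lp.coeFn_sub, Pi.sub_apply]
      exact pow_le_pow_left₀ (norm_nonneg _) (hk i) 2
  simp only [← norm_sq_eq_tsum, tsum_zero] at h
  have h2 := h.sqrt
  simpa [Real.sqrt_sq (norm_nonneg _)] using h2

/-- `B` is the diagonal operator with blocks `M i` on its maximal domain. -/
def IsDiagonal (Φ : X ≃ₗᵢ[ℂ] lp G 2) (M : ∀ i, G i →L[ℂ] G i) (B : X →ₗ.[ℂ] X) : Prop :=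
  ∀ x y, (x, y) ∈ B.graph ↔ ∀ i, M i (Φ x i) = Φ y i

namespace IsDiagonal

variable {Φ : X ≃ₗᵢ[ℂ] lp G 2} {M : ∀ i, G i →L[ℂ] G i} {B : X →ₗ.[ℂ] X}

theorem coord_apply (h : IsDiagonal Φ M B) (x : B.domain) (i : ι) : Φ (B x) i = M i (Φ x i) :=
  ((h x (B x)).1 (B.mem_graph x) i).symm

/-- Maximality of the domain makes the graph an intersection of closed conditions, one for each
coordinate. -/
theorem isClosed (h : IsDiagonal Φ M B) : B.IsClosed := by
  have e : (B.graph : Set (X × X)) = ⋂ i, {z | M i (Φ z.1 i) = Φ z.2 i} := by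
    ext ⟨x, y⟩
    simpa using h x y
  rw [LinearPMap.IsClosed, e]
  exact isClosed_iInter fun i => isClosed_eq
    ((M i).continuous.comp ((continuous_coord Φ i).comp continuous_fst))
    ((continuous_coord Φ i).comp continuous_snd)

theorem single_mem_graph [DecidableEq ι] (h : IsDiagonal Φ M B) (i : ι) (a : G i) :
    (Φ.symm (lp.single 2 i a), Φ.symm (lp.single 2 i (M i a))) ∈ B.graph := by
  rw [h]
  intro j
  simp only [Φ.apply_symm_apply]
  by_cases hj : j = i
  · subst hj
    simp
  · simp [hj]

theorem dense_domain [CompleteSpace X] (h : IsDiagonal Φ M B) : Dense (B.domain : Set X) := by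
  classical
  rw [Submodule.dense_iff_topologicalClosure_eq_top,
    Submodule.topologicalClosure_eq_top_iff, eq_bot_iff]
  intro x hx
  rw [Submodule.mem_bot, ← Φ.map_eq_zero_iff]
  ext i : 2
  -- Testing orthogonality against the `i`-th component of `x` itself leaves `⟪Φ x i, Φ x i⟫ = 0`.
  have hm := LinearPMap.mem_domain_of_mem_graph (h.single_mem_graph i (Φ x i))
  have := (Submodule.mem_orthogonal _ _).1 hx _ hm
  rw [inner_symm_single] at this
  exact inner_self_eq_zero.1 this

theorem hasSum_re_inner (h : IsDiagonal Φ M B) (x : B.domain) :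
    HasSum (fun i => (⟪M i (Φ x i), Φ x i⟫_ℂ).re) (⟪B x, (x : X)⟫_ℂ).re := by
  have := Complex.hasSum_re (hasSum_inner_coord Φ (B x) x)
  simpa only [h.coord_apply] using this

theorem isDissipative (h : IsDiagonal Φ M B) (hM : ∀ i x, (⟪M i x, x⟫_ℂ).re ≤ 0) :
    IsDissipative B := fun x =>
  hasSum_le (fun i => hM i _) (h.hasSum_re_inner x) hasSum_zero

/-- The adjoint need not be computed. Pairing `B.adjoint y` with the `i`-th component of `y`, which
lies in the domain of `B`, shows that the `i`-th term of `⟪B.adjoint y, y⟫` is `⟪Φ y i, M i (Φ y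
i)⟫`. Its real part is that of `⟪M i (Φ y i), Φ y i⟫`. -/
theorem isDissipative_adjoint [CompleteSpace X] (h : IsDiagonal Φ M B)
    (hM : ∀ i x, (⟪M i x, x⟫_ℂ).re ≤ 0) : IsDissipative B.adjoint := by
  classical
  intro y
  refine hasSum_le (fun i => ?_) (Complex.hasSum_re (hasSum_inner_coord Φ (B.adjoint y) y))
    hasSum_zero
  have hg := h.single_mem_graph i (Φ y i)
  obtain ⟨a, ha, hb⟩ := (LinearPMap.mem_graph_iff _).1 hg
  have h1 := LinearPMap.adjoint_isFormalAdjoint h.dense_domain y a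
  simp only at ha hb
  rw [hb, ha, ← inner_conj_symm, inner_symm_single, ← inner_conj_symm (y : X), inner_symm_single,
    inner_conj_symm, inner_conj_symm] at h1
  rw [h1, ← inner_conj_symm, Complex.conj_re]
  exact hM i _

variable [∀ i, CompleteSpace (G i)]

/-- The semigroup of a diagonal operator with dissipative blocks. -/
noncomputable def semigroup (Φ : X ≃ₗᵢ[ℂ] lp G 2) (M : ∀ i, G i →L[ℂ] G i)
    (hM : ∀ i x, (⟪M i x, x⟫_ℂ).re ≤ 0) (t : ℝ≥0) : X →L[ℂ] X :=
  LinearMap.mkContinuous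
    (Φ.symm.toLinearEquiv.toLinearMap ∘ₗ
      { toFun := fun w => ⟨fun i => NormedSpace.exp (((t : ℝ) : ℂ) • M i) (w i),
          (lp.memℓp w).mono' fun i => norm_exp_smul_apply_le (hM i) t.2 _⟩
        map_add' := fun v w => by ext i : 2; exact map_add _ _ _
        map_smul' := fun c w => by ext i : 2; exact map_smul _ _ _ } ∘ₗ
      Φ.toLinearEquiv.toLinearMap) 1 fun x => by
    rw [one_mul]
    refine le_of_sq_le_sq ?_ (norm_nonneg _)
    rw [norm_sq_eq_tsum Φ, norm_sq_eq_tsum Φ]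
    refine Summable.tsum_le_tsum (fun i => ?_) (summable_norm_sq Φ _) (summable_norm_sq Φ _)
    refine pow_le_pow_left₀ (norm_nonneg _) ?_ 2
    simpa using norm_exp_smul_apply_le (hM i) t.2 (Φ x i)

theorem coord_semigroup (hM : ∀ i x, (⟪M i x, x⟫_ℂ).re ≤ 0) (t : ℝ≥0) (x : X) (i : ι) :
    Φ (semigroup Φ M hM t x) i = NormedSpace.exp (((t : ℝ) : ℂ) • M i) (Φ x i) := by
  simp [semigroup]

theorem isContractionSemigroup (hM : ∀ i x, (⟪M i x, x⟫_ℂ).re ≤ 0) :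
    IsContractionSemigroup (semigroup Φ M hM) where
  zero := by
    ext x
    apply Φ.injective
    ext i : 2
    simp [coord_semigroup]
  add s t := by
    ext x
    apply Φ.injective
    ext i : 2
    simp only [coord_semigroup, ContinuousLinearMap.comp_apply]
    let _ : NormedAlgebra ℚ (G i →L[ℂ] G i) := .restrictScalars ℚ ℂ _
    rw [NNReal.coe_add, Complex.ofReal_add, add_smul, NormedSpace.exp_add_of_commute,
      mul_apply_eq_comp]
    exact ((Commute.refl (M i)).smul_left _).smul_right _
  continuous x := by
    -- The majorant is the triangle inequality combined with contractivity of each block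
    -- exponential.
    refine tendsto_of_coord Φ (b := fun i => 2 * ‖Φ x i‖) ?_ (fun i => ?_) (.of_forall fun t i => ?_)
    · simpa only [mul_pow] using (summable_norm_sq Φ x).mul_left (2 ^ 2)
    · simpa only [coord_semigroup] using tendsto_exp_smul_apply (M i) (Φ x i)
    · rw [coord_semigroup]
      linarith [norm_sub_le (NormedSpace.exp (((t : ℝ) : ℂ) • M i) (Φ x i)) (Φ x i),
        norm_exp_smul_apply_le (hM i) t.coe_nonneg (Φ x i)]
  contraction t := LinearMap.mkContinuous_norm_le _ zero_le_one _

/-- On the domain, the block difference quotients are bounded by `‖Φ y i‖`, so dominated convergence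
applies. Conversely, a limit of the quotients can be read off in each coordinate, and the maximal
domain asks for nothing more. -/
theorem isGeneratorOf (h : IsDiagonal Φ M B) (hM : ∀ i x, (⟪M i x, x⟫_ℂ).re ≤ 0) :
    IsGeneratorOf B (semigroup Φ M hM) := by
  intro x y
  have e : ∀ (t : ℝ≥0) i, Φ (((t : ℝ) : ℂ)⁻¹ • (semigroup Φ M hM t x - x)) i =
      ((t : ℝ) : ℂ)⁻¹ • (NormedSpace.exp (((t : ℝ) : ℂ) • M i) (Φ x i) - Φ x i) := fun t i => by
    simp only [map_smul, map_sub, lp.coeFn_smul, lp.coeFn_sub, Pi.smul_apply, Pi.sub_apply,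
      coord_semigroup]
  rw [h]
  constructor
  · intro hxy
    refine tendsto_of_coord Φ (b := fun i => 2 * ‖Φ y i‖) ?_ (fun i => ?_) ?_
    · simpa only [mul_pow] using (summable_norm_sq Φ y).mul_left (2 ^ 2)
    · simp only [e, ← hxy]
      exact tendsto_slope_exp_smul_apply (M i) (Φ x i)
    · filter_upwards [self_mem_nhdsWithin] with t ht i
      have ht' : (0 : ℝ) < t := NNReal.coe_pos.2 ht
      have h1 : ‖((t : ℝ) : ℂ)⁻¹ • (NormedSpace.exp (((t : ℝ) : ℂ) • M i) (Φ x i) - Φ x i)‖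
          ≤ ‖Φ y i‖ := by
        rw [norm_smul, norm_inv, Complex.norm_real, Real.norm_of_nonneg ht'.le,
          inv_mul_le_iff₀ ht', ← hxy, mul_comm]
        exact norm_exp_smul_apply_sub_le (hM i) ht'.le _
      rw [e]
      linarith [norm_sub_le (((t : ℝ) : ℂ)⁻¹ •
        (NormedSpace.exp (((t : ℝ) : ℂ) • M i) (Φ x i) - Φ x i)) (Φ y i)]
  · intro hlim i
    have h1 := ((continuous_coord Φ i).tendsto y).comp hlim
    refine tendsto_nhds_unique (tendsto_slope_exp_smul_apply (M i) (Φ x i)) (h1.congr fun t => ?_)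
    exact e t i

end IsDiagonal

end Diagonal

end Thermoelastic

/-! ### Energy coordinates on the state space and the block matrices. -/

namespace Thermoelastic

/-- A family of isometric embeddings with adjoints `C i` that separate points and satisfy the
orthogonality relations identifies a Hilbert space with a Hilbert sum. -/
theorem exists_coordinates {X : Type*} [NormedAddCommGroup X] [InnerProductSpace ℂ X]
    [CompleteSpace X] {ι : Type*} [DecidableEq ι] {G : ι → Type*} [∀ i, NormedAddCommGroup (G i)]
    [∀ i, InnerProductSpace ℂ (G i)] [∀ i, CompleteSpace (G i)]
    (V : ∀ i, G i →ₗ[ℂ] X) (C : ∀ i, X →ₗ[ℂ] G i)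
    (hadj : ∀ i a x, ⟪V i a, x⟫_ℂ = ⟪a, C i x⟫_ℂ) (hCV : ∀ i a, C i (V i a) = a)
    (hCV' : ∀ i j, i ≠ j → ∀ a, C i (V j a) = 0) (hC : ∀ x, (∀ i, C i x = 0) → x = 0) :
    ∃ Φ : X ≃ₗᵢ[ℂ] lp G 2, ∀ x i, Φ x i = C i x := by
  let J : ∀ i, G i →ₗᵢ[ℂ] X := fun i => (V i).isometryOfInner fun a b => by rw [hadj, hCV]
  have horth : OrthogonalFamily ℂ G J := fun i j hij a b => by
    change ⟪V i a, V j b⟫_ℂ = 0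
    rw [hadj, hCV' i j hij, inner_zero_right]
  have hsum : IsHilbertSum ℂ G J := by
    refine IsHilbertSum.mk horth (le_of_eq ?_)
    rw [eq_comm, Submodule.topologicalClosure_eq_top_iff, eq_bot_iff]
    intro x hx
    refine hC x fun i => ?_
    -- With this test vector the adjoint relation gives `⟪C i x, C i x⟫ = 0`.
    have h := (Submodule.mem_orthogonal _ _).1 hx (V i (C i x))
      (Submodule.mem_iSup_of_mem i ⟨C i x, rfl⟩)
    rw [hadj] at h
    exact inner_self_eq_zero.1 h
  refine ⟨hsum.linearIsometryEquiv, fun x i => ext_inner_left ℂ fun a => ?_⟩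
  rw [← hadj, ← inner_symm_single, hsum.linearIsometryEquiv_symm_apply_single]
  rfl

namespace PositiveOperator

variable {H : Type*} [NormedAddCommGroup H] [InnerProductSpace ℂ H] [CompleteSpace H]
variable (A : PositiveOperator H)

/-- Blocks are indexed by all real `l`. This disposes of those with `l ≤ 0`, where the weights need
not be positive. -/
theorem eq_zero_of_nonpos {l : ℝ} (hl : l ≤ 0) (x : A.eig l) : x = 0 := by
  obtain ⟨c, hc, h⟩ := A.exists_le_of_eig
  by_contra hx
  linarith [h l x hx]

theorem expand_coe (l : ℝ) (x : A.eig l) : A.expand x = Pi.single l x := by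
  funext k
  by_cases hk : k = l
  · subst hk
    simp
  · rw [Pi.single_eq_of_ne hk, expand_apply, Submodule.orthogonalProjectionOnto_eq_zero_iff,
      Submodule.mem_orthogonal]
    exact fun u hu => A.orthogonalFamily_eig hk ⟨u, hu⟩ x

theorem formalPow_expand_coe (s l : ℝ) (x : A.eig l) :
    A.formalPow s (A.expand x) = A.expand (((l ^ s : ℝ) : ℂ) • (x : H)) := by
  rw [map_smul, expand_coe]
  funext k
  by_cases hk : k = l
  · subst hk
    simp [formalPow]
  · simp [formalPow, hk]

theorem eig_le_powDomain (s l : ℝ) : A.eig l ≤ A.powDomain s := fun x hx =>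
  ⟨_, (A.formalPow_expand_coe s l ⟨x, hx⟩).symm⟩

theorem inner_coe_left {l : ℝ} (x : A.eig l) (y : H) : ⟪(x : H), y⟫_ℂ = ⟪x, A.expand y l⟫_ℂ :=
  (Submodule.inner_orthogonalProjectionOnto_eq_of_mem_left x y).symm

end PositiveOperator

variable {H : Type*} [NormedAddCommGroup H] [InnerProductSpace ℂ H] [CompleteSpace H]
variable (A : PositiveOperator H) (p : Params)

open StateSpace

/-- The energy weight of the component `u` on the eigenspace of `l`. -/
noncomputable def weightU (l : ℝ) : ℝ := √p.σ * l ^ (1 / 2 : ℝ)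

/-- The energy weight of the component `v` on the eigenspace of `l`. -/
noncomputable def weightV (l : ℝ) : ℝ := √(1 + p.m * l ^ p.γ)

theorem weightU_pos {l : ℝ} (hl : 0 < l) : 0 < weightU p l :=
  mul_pos (Real.sqrt_pos.2 p.σ_pos) (Real.rpow_pos_of_pos hl _)

theorem inertia_pos {l : ℝ} (hl : 0 < l) : 0 < 1 + p.m * l ^ p.γ := by
  have := p.m_pos
  positivity

theorem weightV_pos {l : ℝ} (hl : 0 < l) : 0 < weightV p l :=
  Real.sqrt_pos.2 (inertia_pos p hl)

theorem weightU_sq {l : ℝ} (hl : 0 < l) : weightU p l ^ 2 = p.σ * l := by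
  rw [weightU, mul_pow, Real.sq_sqrt p.σ_pos.le, ← Real.rpow_natCast, ← Real.rpow_mul hl.le]
  norm_num

theorem weightV_sq {l : ℝ} (hl : 0 < l) : weightV p l ^ 2 = 1 + p.m * l ^ p.γ :=
  Real.sq_sqrt (inertia_pos p hl).le

/-- The space of states supported on the eigenspace of `l`, in coordinates in which the energy
norm is the Euclidean norm. -/
abbrev Block (l : ℝ) : Type _ := PiLp 2 fun _ : Fin 4 => A.eig l

/-- The coordinates of a state on the eigenspace of `l`. -/
noncomputable def coord (l : ℝ) : StateSpace A p →ₗ[ℂ] Block A l :=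
  (WithLp.linearEquiv 2 ℂ (Fin 4 → A.eig l)).symm.toLinearMap ∘ₗ LinearMap.pi
    ![((weightU p l : ℝ) : ℂ) •
        (LinearMap.proj l ∘ₗ A.expand ∘ₗ (A.powDomain (1 / 2)).subtype ∘ₗ u A p),
      ((weightV p l : ℝ) : ℂ) •
        (LinearMap.proj l ∘ₗ A.expand ∘ₗ (A.powDomain (p.γ / 2)).subtype ∘ₗ v A p),
      LinearMap.proj l ∘ₗ A.expand ∘ₗ θ A p,
      ((√p.τ : ℝ) : ℂ) • (LinearMap.proj l ∘ₗ A.expand ∘ₗ q A p)]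

variable {A p} in
theorem coord_eq_iff {l : ℝ} {U : StateSpace A p} {a : Block A l} : coord A p l U = a ↔
    ((weightU p l : ℝ) : ℂ) • A.expand (u A p U) l = a 0 ∧
    ((weightV p l : ℝ) : ℂ) • A.expand (v A p U) l = a 1 ∧
    A.expand (θ A p U) l = a 2 ∧ ((√p.τ : ℝ) : ℂ) • A.expand (q A p U) l = a 3 := by
  rw [PiLp.ext_iff, Fin.forall_fin_succ, Fin.forall_fin_succ, Fin.forall_fin_succ,
    Fin.forall_fin_succ]
  simp only [IsEmpty.forall_iff, and_true]
  rfl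

theorem coord_zero (l : ℝ) (U : StateSpace A p) :
    coord A p l U 0 = ((weightU p l : ℝ) : ℂ) • A.expand (u A p U) l := rfl

theorem coord_one (l : ℝ) (U : StateSpace A p) :
    coord A p l U 1 = ((weightV p l : ℝ) : ℂ) • A.expand (v A p U) l := rfl

theorem coord_two (l : ℝ) (U : StateSpace A p) : coord A p l U 2 = A.expand (θ A p U) l := rfl

theorem coord_three (l : ℝ) (U : StateSpace A p) :
    coord A p l U 3 = ((√p.τ : ℝ) : ℂ) • A.expand (q A p U) l := rfl

/-- The embedding of a block into the state space. -/
noncomputable def embed (l : ℝ) : Block A l →ₗ[ℂ] StateSpace A p where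
  toFun a := StateSpace.mk A p
    ⟨((weightU p l : ℝ) : ℂ)⁻¹ • (a 0 : H), A.eig_le_powDomain _ l (Submodule.smul_mem _ _ (a 0).2)⟩
    ⟨((weightV p l : ℝ) : ℂ)⁻¹ • (a 1 : H), A.eig_le_powDomain _ l (Submodule.smul_mem _ _ (a 1).2)⟩
    (a 2) (((√p.τ : ℝ) : ℂ)⁻¹ • (a 3 : H))
  map_add' a b := by
    apply StateSpace.ext A p <;> simp
  map_smul' c a := by
    apply StateSpace.ext A p <;> simp [smul_comm c]

theorem expand_halfU_apply (U : StateSpace A p) (l : ℝ) :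
    A.expand (halfU A p U) l = ((l ^ (1 / 2 : ℝ) : ℝ) : ℂ) • A.expand (u A p U) l := by
  rw [expand_halfU]
  rfl

theorem expand_halfV_apply (U : StateSpace A p) (l : ℝ) :
    A.expand (halfV A p U) l = ((l ^ (p.γ / 2) : ℝ) : ℂ) • A.expand (v A p U) l := by
  rw [expand_halfV]
  rfl

theorem halfU_embed (l : ℝ) (a : Block A l) : halfU A p (embed A p l a) =
    ((l ^ (1 / 2 : ℝ) * (weightU p l)⁻¹ : ℝ) : ℂ) • (a 0 : H) := by
  apply A.expand_injective
  rw [expand_halfU, Complex.ofReal_mul, Complex.ofReal_inv, mul_smul, ← Submodule.coe_smul,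
    ← A.formalPow_expand_coe]
  rfl

theorem halfV_embed (l : ℝ) (a : Block A l) : halfV A p (embed A p l a) =
    ((l ^ (p.γ / 2) * (weightV p l)⁻¹ : ℝ) : ℂ) • (a 1 : H) := by
  apply A.expand_injective
  rw [expand_halfV, Complex.ofReal_mul, Complex.ofReal_inv, mul_smul, ← Submodule.coe_smul,
    ← A.formalPow_expand_coe]
  rfl

variable {A} in
theorem Block.eq_zero_of_nonpos {l : ℝ} (hl : l ≤ 0) (a : Block A l) : a = 0 := by
  ext i : 1
  exact A.eq_zero_of_nonpos hl _

/-- The weights are chosen for this adjoint relation: `weightU` squared is `σ l`, and `weightV`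
squared is `1 + m l ^ γ`, which collects both energy terms in `v`. -/
theorem inner_embed (l : ℝ) (a : Block A l) (U : StateSpace A p) :
    ⟪embed A p l a, U⟫_ℂ = ⟪a, coord A p l U⟫_ℂ := by
  rcases le_or_gt l 0 with hl | hl
  · rw [Block.eq_zero_of_nonpos hl a, map_zero, inner_zero_left, inner_zero_left]
  have hU := (weightU_pos p hl).ne'
  have hV := (weightV_pos p hl).ne'
  have hτ := (Real.sqrt_pos.2 p.τ_pos).ne'
  have e1 : p.σ * (l ^ (1 / 2 : ℝ) * (weightU p l)⁻¹) * l ^ (1 / 2 : ℝ) = weightU p l := by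
    have h : l ^ (1 / 2 : ℝ) * l ^ (1 / 2 : ℝ) = l := by rw [← Real.rpow_add hl]; norm_num
    field_simp
    rw [weightU_sq p hl, pow_two, h]
  have e2 : p.m * (l ^ (p.γ / 2) * (weightV p l)⁻¹) * l ^ (p.γ / 2) + (weightV p l)⁻¹
      = weightV p l := by
    have h : l ^ (p.γ / 2) * l ^ (p.γ / 2) = l ^ p.γ := by rw [← Real.rpow_add hl]; ring_nf
    field_simp
    rw [weightV_sq p hl, pow_two, h]
    ring
  have e3 : p.τ * (√p.τ)⁻¹ = √p.τ := by
    field_simp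
    exact (Real.sq_sqrt p.τ_pos.le).symm
  have c2 : ((v A p (embed A p l a) : _) : H) = (((weightV p l)⁻¹ : ℝ) : ℂ) • (a 1 : H) := by
    rw [Complex.ofReal_inv]; rfl
  have c3 : θ A p (embed A p l a) = a 2 := rfl
  have c4 : q A p (embed A p l a) = (((√p.τ)⁻¹ : ℝ) : ℂ) • (a 3 : H) := by
    rw [Complex.ofReal_inv]; rfl
  rw [inner_def, halfU_embed, halfV_embed, c2, c3, c4, PiLp.inner_apply]
  simp only [inner_smul_left, Complex.conj_ofReal, A.inner_coe_left, expand_halfU_apply,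
    expand_halfV_apply, inner_smul_right, Fin.sum_univ_four, coord_zero, coord_one, coord_two,
    coord_three]
  -- The weights coming from `coord` are replaced by the coefficients that the energy inner product
  -- produces, after which both sides have the same terms.
  rw [← congrArg ((↑) : ℝ → ℂ) e1, ← congrArg ((↑) : ℝ → ℂ) e2, ← congrArg ((↑) : ℝ → ℂ) e3]
  push_cast
  ring

theorem coord_embed (l : ℝ) (a : Block A l) : coord A p l (embed A p l a) = a := by
  rcases le_or_gt l 0 with hl | hl
  · rw [Block.eq_zero_of_nonpos hl a, map_zero, map_zero]
  have hU : ((weightU p l : ℝ) : ℂ) ≠ 0 := by exact_mod_cast (weightU_pos p hl).ne'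
  have hV : ((weightV p l : ℝ) : ℂ) ≠ 0 := by exact_mod_cast (weightV_pos p hl).ne'
  have hτ : ((√p.τ : ℝ) : ℂ) ≠ 0 := by exact_mod_cast (Real.sqrt_pos.2 p.τ_pos).ne'
  rw [coord_eq_iff]
  simp [embed, A.expand_coe, smul_smul, hU, hV, hτ, -PositiveOperator.expand_apply]

theorem coord_embed_of_ne {k l : ℝ} (h : k ≠ l) (a : Block A l) :
    coord A p k (embed A p l a) = 0 := by
  rw [coord_eq_iff]
  simp [embed, A.expand_coe, h, -PositiveOperator.expand_apply]

theorem eq_zero_of_coord_eq_zero (U : StateSpace A p) (h : ∀ l, coord A p l U = 0) : U = 0 := by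
  have key : ∀ x : H, (∀ l, 0 < l → A.expand x l = 0) → x = 0 := fun x hx => by
    apply A.expand_injective
    funext l
    rcases le_or_gt l 0 with hl | hl
    · rw [A.eq_zero_of_nonpos hl (A.expand x l), map_zero]; rfl
    · rw [hx l hl, map_zero]; rfl
  have hc := fun l => coord_eq_iff.1 (h l)
  apply StateSpace.ext A p
  · refine (key _ fun l hl => (smul_eq_zero.1 (hc l).1).resolve_left ?_).trans (by simp)
    exact_mod_cast (weightU_pos p hl).ne'
  · refine (key _ fun l hl => (smul_eq_zero.1 (hc l).2.1).resolve_left ?_).trans (by simp)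
    exact_mod_cast (weightV_pos p hl).ne'
  · exact (key _ fun l hl => (hc l).2.2.1).trans (by simp)
  · refine (key _ fun l hl => (smul_eq_zero.1 (hc l).2.2.2).resolve_left ?_).trans (by simp)
    exact_mod_cast (Real.sqrt_pos.2 p.τ_pos).ne'

theorem exists_isometry_coord :
    ∃ Φ : StateSpace A p ≃ₗᵢ[ℂ] lp (fun l => Block A l) 2, ∀ U l, Φ U l = coord A p l U :=
  exists_coordinates (embed A p) (coord A p) (inner_embed A p) (coord_embed A p)
    (fun _ _ h => coord_embed_of_ne A p h) (eq_zero_of_coord_eq_zero A p)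

/-- The system operator on the eigenspace of `l`, in the coordinates `coord`. -/
noncomputable def block (l : ℝ) : Block A l →L[ℂ] Block A l :=
  (PiLp.continuousLinearEquiv 2 ℂ fun _ : Fin 4 => A.eig l).symm.toContinuousLinearMap ∘L
    ContinuousLinearMap.pi
      ![((weightU p l / weightV p l : ℝ) : ℂ) • PiLp.proj 2 _ 1,
        -((weightU p l / weightV p l : ℝ) : ℂ) • PiLp.proj 2 _ 0
          + ((l ^ p.α / weightV p l : ℝ) : ℂ) • PiLp.proj 2 _ 2,
        -((l ^ p.α / weightV p l : ℝ) : ℂ) • PiLp.proj 2 _ 1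
          + ((l ^ (p.β / 2) / √p.τ : ℝ) : ℂ) • PiLp.proj 2 _ 3,
        -((l ^ (p.β / 2) / √p.τ : ℝ) : ℂ) • PiLp.proj 2 _ 2
          - ((p.τ⁻¹ : ℝ) : ℂ) • PiLp.proj 2 _ 3]

section block

variable (l : ℝ) (a : Block A l)

theorem block_zero : block A p l a 0 = ((weightU p l / weightV p l : ℝ) : ℂ) • a 1 := rfl

theorem block_one : block A p l a 1 = -((weightU p l / weightV p l : ℝ) : ℂ) • a 0
    + ((l ^ p.α / weightV p l : ℝ) : ℂ) • a 2 := rfl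

theorem block_two : block A p l a 2 = -((l ^ p.α / weightV p l : ℝ) : ℂ) • a 1
    + ((l ^ (p.β / 2) / √p.τ : ℝ) : ℂ) • a 3 := rfl

theorem block_three : block A p l a 3 = -((l ^ (p.β / 2) / √p.τ : ℝ) : ℂ) • a 2
    - ((p.τ⁻¹ : ℝ) : ℂ) • a 3 := rfl

/-- The couplings `u`–`v`, `v`–`θ` and `θ`–`q` enter with opposite real coefficients, so they cancel
in the real part and only the damping of `q` survives. -/
theorem re_inner_block : (⟪block A p l a, a⟫_ℂ).re = -(p.τ⁻¹ * ‖a 3‖ ^ 2) := by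
  have hs : ∀ x y : A.eig l, (⟪x, y⟫_ℂ).re = (⟪y, x⟫_ℂ).re := fun x y => inner_re_symm (𝕜 := ℂ) x y
  have hn : (⟪a 3, a 3⟫_ℂ).re = ‖a 3‖ ^ 2 := inner_self_eq_norm_sq (𝕜 := ℂ) (a 3)
  rw [PiLp.inner_apply, Fin.sum_univ_four, block_zero, block_one, block_two, block_three]
  simp only [neg_smul, inner_add_left, inner_sub_left, inner_neg_left, inner_smul_left,
    Complex.conj_ofReal, Complex.add_re, Complex.sub_re, Complex.neg_re, Complex.re_ofReal_mul, hn]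
  rw [hs (a 1) (a 0), hs (a 2) (a 1), hs (a 3) (a 2)]
  ring

end block

end Thermoelastic

/-! ### The system operator is the maximal block-diagonal operator. -/

namespace Thermoelastic

variable {H : Type*} [NormedAddCommGroup H] [InnerProductSpace ℂ H] [CompleteSpace H]
variable (A : PositiveOperator H) (p : Params)

open StateSpace

/-- Passing from `A ^ (γ / 2) (I + m A ^ γ)⁻¹ f` to `A ^ (-γ / 2) f` multiplies by `l ^ (-γ) + m`,
which is bounded because the eigenvalues stay away from `0`. As the converse of
`invInertia_mem_scale`, this makes the domain condition on the stress maximal. -/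
theorem mem_scale_of_invInertia (hγ : 0 ≤ p.γ) {f : A.FormalSeries}
    (hf : invInertia A p f ∈ A.scale (p.γ / 2)) : f ∈ A.scale (-(p.γ / 2)) := by
  obtain ⟨c, hc, hl⟩ := A.exists_le_of_eig
  have hm := p.m_pos
  have h := A.mult_mem_inH (g := fun l => l ^ (-p.γ) + p.m) (C := c ^ (-p.γ) + p.m)
    (fun l x hx => by
      have h1 := hl l x hx
      have h2 : 0 < l ^ (-p.γ) := Real.rpow_pos_of_pos (hc.trans_le h1) _
      rw [abs_of_pos (by positivity)]
      have := Real.rpow_le_rpow_of_nonpos hc h1 (neg_nonpos.2 hγ)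
      linarith) hf
  rw [PositiveOperator.formalPow, A.mult_mult, invInertia, A.mult_mult] at h
  change A.mult _ f ∈ A.inH
  convert h using 1
  refine A.mult_congr _ fun l hl => ?_
  have h1 := (inertia_pos p hl).ne'
  have h3 : l ^ p.γ = l ^ (p.γ / 2) * l ^ (p.γ / 2) := by rw [← Real.rpow_add hl]; ring_nf
  have h2 : 0 < l ^ (p.γ / 2) := Real.rpow_pos_of_pos hl _
  rw [Real.rpow_neg hl.le, Real.rpow_neg hl.le]
  rw [h3] at h1 ⊢
  field_simp

/-- The system operator is the formal one on its maximal domain. -/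
theorem mem_graph_systemOp (hγ : 0 ≤ p.γ) (U F : StateSpace A p) :
    (U, F) ∈ (systemOp A p).graph ↔
      A.expand (v A p U) = A.expand (u A p F) ∧
      -invInertia A p (stress A p U) = A.expand (v A p F) ∧
      heatBalance A p U = A.expand (θ A p F) ∧
      -fluxBalance A p U = (p.τ : ℂ) • A.expand (q A p F) := by
  have hτ : (p.τ : ℂ) ≠ 0 := by exact_mod_cast p.τ_pos.ne'
  have e : ∀ W : opDomain A p, A.expand (u A p (systemOp A p W)) = A.expand (v A p W) ∧
      A.expand (v A p (systemOp A p W)) = -invInertia A p (stress A p W) ∧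
      A.expand (θ A p (systemOp A p W)) = heatBalance A p W ∧
      (p.τ : ℂ) • A.expand (q A p (systemOp A p W)) = -fluxBalance A p W := fun W => by
    refine ⟨rfl, expand_acceleration A p W, A.expand_realize _, ?_⟩
    change (p.τ : ℂ) • A.expand ((p.τ : ℂ)⁻¹ • A.realize _) = _
    rw [map_smul, A.expand_realize, smul_smul, mul_inv_cancel₀ hτ, one_smul]
    rfl
  rw [LinearPMap.mem_graph_iff]
  constructor
  · rintro ⟨W, rfl, rfl⟩
    obtain ⟨h1, h2, h3, h4⟩ := e W
    exact ⟨h1.symm, h2.symm, h3.symm, h4.symm⟩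
  · rintro ⟨h1, h2, h3, h4⟩
    -- Each domain condition follows from its equation, since the right-hand sides come from
    -- components of the state `F`.
    have hU : U ∈ opDomain A p := by
      refine ⟨?_, ?_, ⟨_, h3.symm⟩, ?_⟩
      · rw [A.expand_injective h1]
        exact (u A p F).2
      · apply mem_scale_of_invInertia A p hγ
        rw [← neg_mem_iff, h2]
        exact (v A p F).2
      · rw [← neg_mem_iff, h4]
        exact Submodule.smul_mem _ _ ⟨_, rfl⟩
    obtain ⟨k1, k2, k3, k4⟩ := e ⟨U, hU⟩
    refine ⟨⟨U, hU⟩, rfl, StateSpace.ext A p ?_ ?_ ?_ ?_⟩ <;> apply A.expand_injective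
    · exact k1.trans h1
    · exact k2.trans h2
    · exact k3.trans h3
    · apply smul_right_injective _ hτ
      exact k4.trans h4

/-- For `l > 0` the weights are nonzero. The scaled and unscaled equations therefore differ only by
the factors `weightU`, `weightV`, `1` and `√τ` in the four rows. -/
theorem block_coord_eq_iff {l : ℝ} (hl : 0 < l) (U F : StateSpace A p) :
    block A p l (coord A p l U) = coord A p l F ↔
      A.expand (v A p U) l = A.expand (u A p F) l ∧
      -invInertia A p (stress A p U) l = A.expand (v A p F) l ∧
      heatBalance A p U l = A.expand (θ A p F) l ∧
      -fluxBalance A p U l = (p.τ : ℂ) • A.expand (q A p F) l := by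
  have hU : ((weightU p l : ℝ) : ℂ) ≠ 0 := by exact_mod_cast (weightU_pos p hl).ne'
  have hV : ((weightV p l : ℝ) : ℂ) ≠ 0 := by exact_mod_cast (weightV_pos p hl).ne'
  have hτ : ((√p.τ : ℝ) : ℂ) ≠ 0 := by exact_mod_cast (Real.sqrt_pos.2 p.τ_pos).ne'
  have hτ2 : (p.τ : ℂ) = ((√p.τ : ℝ) : ℂ) ^ 2 := by exact_mod_cast (Real.sq_sqrt p.τ_pos.le).symm
  have s1 : stress A p U l = ((weightU p l : ℝ) : ℂ) ^ 2 • A.expand (u A p U) l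
      - ((l ^ p.α : ℝ) : ℂ) • A.expand (θ A p U) l := by
    rw [← Complex.ofReal_pow, weightU_sq p hl, Complex.ofReal_mul, mul_smul]
    simp [stress, PositiveOperator.formalPow]
  have s2 : invInertia A p (stress A p U) l
      = (((weightV p l : ℝ) : ℂ) ^ 2)⁻¹ • stress A p U l := by
    rw [← Complex.ofReal_pow, weightV_sq p hl, ← Complex.ofReal_inv]
    rfl
  have s3 : heatBalance A p U l = -(((l ^ p.α : ℝ) : ℂ) • A.expand (v A p U) l)
      + ((l ^ (p.β / 2) : ℝ) : ℂ) • A.expand (q A p U) l := rfl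
  have s4 : fluxBalance A p U l = A.expand (q A p U) l
      + ((l ^ (p.β / 2) : ℝ) : ℂ) • A.expand (θ A p U) l := rfl
  rw [eq_comm, coord_eq_iff, block_zero, block_one, block_two, block_three, coord_zero, coord_one,
    coord_two, coord_three, s2, s1, s3, s4]
  simp only [Complex.ofReal_div, Complex.ofReal_inv, hτ2]
  refine and_congr ?_ (and_congr ?_ (and_congr ?_ ?_))
  · rw [smul_smul, div_mul_cancel₀ _ hV, (smul_right_injective _ hU).eq_iff, eq_comm]
  · rw [eq_comm]
    conv_rhs => rw [← (smul_right_injective _ hV).eq_iff]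
    refine iff_of_eq (congrArg₂ _ ?_ rfl)
    match_scalars <;> field_simp
  · rw [eq_comm]
    refine iff_of_eq (congrArg₂ _ ?_ rfl)
    match_scalars <;> field_simp
  · rw [eq_comm, ← (smul_right_injective _ hτ).eq_iff]
    refine iff_of_eq (congrArg₂ _ ?_ ?_) <;> match_scalars <;> field_simp

theorem isDiagonal_systemOp (hγ : 0 ≤ p.γ)
    {Φ : StateSpace A p ≃ₗᵢ[ℂ] lp (fun l => Block A l) 2} (hΦ : ∀ U l, Φ U l = coord A p l U) :
    IsDiagonal Φ (block A p) (systemOp A p) := by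
  intro U F
  simp only [hΦ]
  have key : ∀ f g : A.FormalSeries, f = g ↔ ∀ l, 0 < l → f l = g l := fun f g => by
    refine ⟨fun h l _ => congrFun h l, fun h => funext fun l => ?_⟩
    rcases le_or_gt l 0 with hl | hl
    · rw [A.eq_zero_of_nonpos hl (f l), A.eq_zero_of_nonpos hl (g l)]
    · exact h l hl
  have key' : (∀ l, block A p l (coord A p l U) = coord A p l F) ↔
      ∀ l, 0 < l → block A p l (coord A p l U) = coord A p l F := by
    refine ⟨fun h l _ => h l, fun h l => ?_⟩
    rcases le_or_gt l 0 with hl | hl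
    · rw [Block.eq_zero_of_nonpos hl (block A p l _), Block.eq_zero_of_nonpos hl (coord A p l F)]
    · exact h l hl
  rw [mem_graph_systemOp A p hγ, key', key, key, key, key]
  simp only [← forall_and]
  exact forall₂_congr fun l hl => (block_coord_eq_iff A p hl U F).symm

/-- Parseval's identity in `H`, used to sum the dissipation of the blocks. -/
theorem hasSum_norm_expand_sq (x : H) : HasSum (fun l => ‖A.expand x l‖ ^ 2) (‖x‖ ^ 2) := by
  have h : ∀ l, A.isHilbertSum.linearIsometryEquiv x l = A.expand x l := fun l => by
    rw [← A.expand_symm, LinearIsometryEquiv.symm_apply_apply]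
  rw [norm_sq_eq_tsum A.isHilbertSum.linearIsometryEquiv x]
  simpa only [h] using (summable_norm_sq A.isHilbertSum.linearIsometryEquiv x).hasSum

end Thermoelastic

open Thermoelastic in
theorem mainTheorem4 {H : Type*} [NormedAddCommGroup H] [InnerProductSpace ℂ H] [CompleteSpace H]
    (A : PositiveOperator H) (p : Params) (hQ : (p.α, p.β, p.γ) ∈ Q) :
    (systemOp A p).IsClosed ∧
    Dense ((systemOp A p).domain : Set (StateSpace A p)) ∧
    (∀ U : (systemOp A p).domain,
      (⟪systemOp A p U, (U : StateSpace A p)⟫_ℂ).re = -‖StateSpace.q A p U‖ ^ 2) ∧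
    IsDissipative (systemOp A p) ∧
    IsDissipative (systemOp A p).adjoint ∧
    ∃ T : ℝ≥0 → StateSpace A p →L[ℂ] StateSpace A p,
      IsContractionSemigroup T ∧ IsGeneratorOf (systemOp A p) T := by
  obtain ⟨Φ, hΦ⟩ := exists_isometry_coord A p
  have hτ := p.τ_pos
  have hd := isDiagonal_systemOp A p hQ.2.2.1.1.le hΦ
  have hM : ∀ l (a : Block A l), (⟪block A p l a, a⟫_ℂ).re ≤ 0 := fun l a => by
    rw [re_inner_block]
    exact neg_nonpos.2 (by positivity)
  refine ⟨hd.isClosed, hd.dense_domain, fun U => ?_, hd.isDissipative hM,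
    hd.isDissipative_adjoint hM, _, IsDiagonal.isContractionSemigroup hM, hd.isGeneratorOf hM⟩
  -- The fourth coordinate carries the factor `√τ`, whose square cancels the `τ⁻¹` of the block
  -- damping.
  have e : ∀ l, (⟪block A p l (Φ U l), Φ U l⟫_ℂ).re =
      -‖A.expand (StateSpace.q A p U) l‖ ^ 2 := fun l => by
    rw [re_inner_block, hΦ, coord_three, norm_smul, Complex.norm_real, mul_pow,
      Real.norm_of_nonneg (Real.sqrt_nonneg _), Real.sq_sqrt hτ.le, inv_mul_cancel_left₀ hτ.ne']
  have h := hd.hasSum_re_inner U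
  simp only [e] at h
  exact h.unique (hasSum_norm_expand_sq A _).neg
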